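/- Let $b,\delta,N>0$, let $g:[0,\delta]\to\mathbb{R}_+$ be a probability density, and set $m_i=\int_0^\delta v^i g(v)\,dv$ for $i=1,2$. Write $\mathbb{R}_+=[0,\infty)$, $\mathbb{R}_+^*=(0,\infty)$; $L^2(\mathbb{R}_+)$ and $H^k(\mathbb{R}_+)$ are the real Lebesgue and Sobolev spaces on the half-line, and $H_0^1(\mathbb{R}_+)$ is the closure of $C_c^\infty(\mathbb{R}_+^*)$ in $H^1(\mathbb{R}_+)$. Let $A:H_0^1(\mathbb{R}_+)\cap H^2(\mathbb{R}_+)\to L^2(\mathbb{R}_+)$ be the operator $Au=bm_1u'+\frac{bm_2}{2N}u''$. For $n_0''\in H_0^1(\mathbb{R}_+)$ consider the Dirichlet problem $$\begin{cases}\partial_t v(t,x)=bm_1\,\partial_x v(t,x)+\frac{bm_2}{2N}\,\partial_x^2 v(t,x), & t\ge 0,\ x\ge 0,\\ v(t,0)=0, & t\ge 0,\\ v(0,x)=n_0''(x), & x\ge 0.\end{cases}$$ A mild solution is a function $v$ such that, for every $t\ge 0$, $\int_0^t v(s)\,ds\in H_0^1(\mathbb{R}_+)\cap H^2(\mathbb{R}_+)$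 and $v(t)=n_0''+A\int_0^t v(s)\,ds$. A strict solution is a function $v\in C^0(\mathbb{R}_+,H_0^1(\mathbb{R}_+)\cap H^2(\mathbb{R}_+))\cap C^1(\mathbb{R}_+,L^2(\mathbb{R}_+))$ with $v(0)=n_0''$ and $\partial_t v(t)=Av(t)$ in $L^2(\mathbb{R}_+)$ for every $t\ge 0$. (i) For every $n_0''\in H_0^1(\mathbb{R}_+)$ there is a unique mild solution in $C^0(\mathbb{R}_+,H_0^1(\mathbb{R}_+))$. (ii) If moreover $n_0''\in H_0^1(\mathbb{R}_+)\cap H^2(\mathbb{R}_+)$, then there is a unique strict solution $v$. It is the mild solution of (i), and it also belongs to $C^1(\mathbb{R}_+^*,H_0^1(\mathbb{R}_+))$. -/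

import Mathlib

open MeasureTheory Set
open scoped NNReal ContDiff

noncomputable section

namespace HalfLine

/-- The real Hilbert space `L²(ℝ₊)`. -/
abbrev L2 : Type := Lp ℝ 2 (volume.restrict (Ioi (0 : ℝ)))

/-- Test functions: smooth functions with compact support contained in the open half-line. -/
structure IsTest (φ : ℝ → ℝ) : Prop where
  smooth : ContDiff ℝ ∞ φ
  compact : HasCompactSupport φ
  supp : tsupport φ ⊆ Ioi 0

/-- `g` is the weak derivative of `f` on the open half-line. -/
def IsWeakDeriv (f g : L2) : Prop :=
  ∀ φ : ℝ → ℝ, IsTest φ →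
    ∫ x in Ioi (0 : ℝ), f x * deriv φ x = - ∫ x in Ioi (0 : ℝ), g x * φ x

theorem IsTest.memLp {φ : ℝ → ℝ} (h : IsTest φ) :
    MemLp φ 2 (volume.restrict (Ioi (0 : ℝ))) :=
  (h.smooth.continuous.memLp_of_hasCompactSupport h.compact).restrict _

theorem IsTest.memLp_deriv {φ : ℝ → ℝ} (h : IsTest φ) :
    MemLp (deriv φ) 2 (volume.restrict (Ioi (0 : ℝ))) :=
  ((h.smooth.continuous_deriv (by simp)).memLp_of_hasCompactSupport h.compact.deriv).restrict _

theorem integrable_mul_of_memLp (f : L2) {ψ : ℝ → ℝ}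
    (h : MemLp ψ 2 (volume.restrict (Ioi (0 : ℝ)))) :
    Integrable (fun x => f x * ψ x) (volume.restrict (Ioi (0 : ℝ))) :=
  (Lp.memLp f).integrable_mul h

theorem integral_add_mul (f f' : L2) {ψ : ℝ → ℝ}
    (h : MemLp ψ 2 (volume.restrict (Ioi (0 : ℝ)))) :
    ∫ x in Ioi (0 : ℝ), (f + f') x * ψ x =
      (∫ x in Ioi (0 : ℝ), f x * ψ x) + ∫ x in Ioi (0 : ℝ), f' x * ψ x := by
  rw [← integral_add (integrable_mul_of_memLp f h) (integrable_mul_of_memLp f' h)]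
  refine integral_congr_ae ?_
  filter_upwards [Lp.coeFn_add f f'] with x hx
  rw [hx, Pi.add_apply, add_mul]

theorem integral_smul_mul (c : ℝ) (f : L2) (ψ : ℝ → ℝ) :
    ∫ x in Ioi (0 : ℝ), (c • f) x * ψ x = c * ∫ x in Ioi (0 : ℝ), f x * ψ x := by
  rw [← integral_const_mul]
  refine integral_congr_ae ?_
  filter_upwards [Lp.coeFn_smul c f] with x hx
  rw [hx, Pi.smul_apply, smul_eq_mul, mul_assoc]

theorem IsWeakDeriv.add {f f' g g' : L2} (h : IsWeakDeriv f g) (h' : IsWeakDeriv f' g') :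
    IsWeakDeriv (f + f') (g + g') := by
  intro φ hφ
  rw [integral_add_mul _ _ hφ.memLp_deriv, integral_add_mul _ _ hφ.memLp, h φ hφ, h' φ hφ]
  ring

theorem IsWeakDeriv.smul (c : ℝ) {f g : L2} (h : IsWeakDeriv f g) :
    IsWeakDeriv (c • f) (c • g) := by
  intro φ hφ
  rw [integral_smul_mul, integral_smul_mul, h φ hφ]
  ring

theorem IsWeakDeriv.zero : IsWeakDeriv 0 0 := by
  simpa using IsWeakDeriv.smul 0 (f := 0) (g := 0)
    (by
      intro φ _
      have h0 : ∀ ψ : ℝ → ℝ, ∫ x in Ioi (0 : ℝ), (0 : L2) x * ψ x = 0 := by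
        intro ψ
        simpa using integral_smul_mul 0 0 ψ
      rw [h0, h0, neg_zero])

/-- The Sobolev space `H^k(ℝ₊)`. An element is the tuple `(u, u', …, u^(k))` of a function of
`L²(ℝ₊)` and its weak derivatives up to order `k`, all of them in `L²(ℝ₊)` (they are determined by
`u`), so that the norm is `(∑ i ≤ k, ‖u^(i)‖²)^(1/2)`, the usual norm of `H^k(ℝ₊)`. -/
def Sobolev (k : ℕ) : Submodule ℝ (PiLp 2 (fun _ : Fin (k + 1) => L2)) where
  carrier := {u | ∀ i : Fin k, IsWeakDeriv (u i.castSucc) (u i.succ)}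
  add_mem' := fun hu hw i => (hu i).add (hw i)
  zero_mem' := fun _ => IsWeakDeriv.zero
  smul_mem' := fun c _ hu i => (hu i).smul c

abbrev H1 : Type := ↥(Sobolev 1)

abbrev H2 : Type := ↥(Sobolev 2)

/-- The inclusion of `H²(ℝ₊)` in `H¹(ℝ₊)`. -/
def H2.toH1 : H2 →ₗ[ℝ] H1 where
  toFun u := ⟨WithLp.toLp 2 (fun i => u.1 i.castSucc), fun i => u.2 i.castSucc⟩
  map_add' _ _ := rfl
  map_smul' _ _ := rfl

/-- The subspace of `H¹(ℝ₊)` of (classes of) test functions. -/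
def testH1 : Submodule ℝ H1 where
  carrier := {u | ∃ φ : ℝ → ℝ, IsTest φ ∧ u.1 0 =ᵐ[volume.restrict (Ioi (0 : ℝ))] φ}
  add_mem' := by
    rintro u w ⟨φ, hφ, hu⟩ ⟨ψ, hψ, hw⟩
    refine ⟨φ + ψ, ⟨hφ.smooth.add hψ.smooth, hφ.compact.add hψ.compact, ?_⟩, ?_⟩
    · exact (tsupport_add φ ψ).trans (union_subset hφ.supp hψ.supp)
    · exact (Lp.coeFn_add (u.1 0) (w.1 0)).trans (hu.add hw)
  zero_mem' := by
    refine ⟨0, ⟨contDiff_const, HasCompactSupport.zero, ?_⟩, Lp.coeFn_zero _ _ _⟩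
    simp [tsupport]
  smul_mem' := by
    rintro c u ⟨φ, hφ, hu⟩
    refine ⟨c • φ, ⟨hφ.smooth.const_smul c, hφ.compact.smul_left (f := fun _ => c), ?_⟩, ?_⟩
    · exact (closure_mono (Function.support_const_smul_subset c φ)).trans hφ.supp
    · exact (Lp.coeFn_smul c (u.1 0)).trans (hu.const_smul c)

/-- `H₀¹(ℝ₊)`, the closure of the test functions in `H¹(ℝ₊)`: these are the functions of `H¹(ℝ₊)`
that satisfy the Dirichlet condition at the origin. It carries the norm of `H¹(ℝ₊)`. -/
def H01 : Submodule ℝ H1 := testH1.topologicalClosure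

/-- `H₀¹(ℝ₊) ∩ H²(ℝ₊)`, with the norm of `H²(ℝ₊)`. -/
def H01H2 : Submodule ℝ H2 := H01.comap H2.toH1

/-- The underlying function in `L²(ℝ₊)` of an element of `H₀¹(ℝ₊)`. -/
def h01ToL2 (u : H01) : L2 := u.1.1 0

/-- The inclusion of `H₀¹(ℝ₊) ∩ H²(ℝ₊)` in `H₀¹(ℝ₊)`. -/
def h01H2ToH01 (u : H01H2) : H01 := ⟨H2.toH1 u.1, u.2⟩

/-- The underlying function in `L²(ℝ₊)` of an element of `H₀¹(ℝ₊) ∩ H²(ℝ₊)`. -/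
def h01H2ToL2 (u : H01H2) : L2 := u.1.1 0

/-- The moment `∫₀^δ vⁱ g(v) dv`. -/
def moment (g : ℝ → ℝ) (δ : ℝ) (i : ℕ) : ℝ := ∫ v in (0 : ℝ)..δ, v ^ i * g v

/-- The operator `u ↦ b m₁ u' + (b m₂ / (2N)) u''` from `H₀¹(ℝ₊) ∩ H²(ℝ₊)` to `L²(ℝ₊)`. -/
def advDiff (b m₁ m₂ N : ℝ) (u : H01H2) : L2 :=
  (b * m₁) • u.1.1 1 + (b * m₂ / (2 * N)) • u.1.1 2

/-- Mild solution of `v' = A v`, `v(0) = f`, where `A` is `advDiff`: for every `t ≥ 0`, the integral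
`∫₀ᵗ v(s) ds` in `L²(ℝ₊)` belongs to the domain of `A`, and `v(t) = f + A ∫₀ᵗ v(s) ds`. -/
def IsMildSolution (b m₁ m₂ N : ℝ) (f : H01) (v : ℝ≥0 → H01) : Prop :=
  ∀ t : ℝ≥0, ∃ V : H01H2,
    h01H2ToL2 V = ∫ s in (0 : ℝ)..t, h01ToL2 (v s.toNNReal) ∧
    h01ToL2 (v t) = h01ToL2 f + advDiff b m₁ m₂ N V

/-- Strict solution of `v' = A v`, `v(0) = f`, where `A` is `advDiff`: the curve `v` is `C¹` on
`[0, ∞)` with values in `L²(ℝ₊)`, and the equation holds in `L²(ℝ₊)` at every `t ≥ 0`. -/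
structure IsStrictSolution (b m₁ m₂ N : ℝ) (f : H01) (v : ℝ≥0 → H01H2) : Prop where
  contDiffOn : ContDiffOn ℝ 1 (fun t : ℝ => h01H2ToL2 (v t.toNNReal)) (Ici 0)
  eqn : ∀ t : ℝ≥0, HasDerivWithinAt (fun s : ℝ => h01H2ToL2 (v s.toNNReal))
    (advDiff b m₁ m₂ N (v t)) (Ici 0) (t : ℝ)
  initial : h01H2ToH01 (v 0) = f

end HalfLine

end

noncomputable section

/-! ### Generation of semigroups from resolvent bounds (Hille–Yosida) -/

namespace HilleYosida

open Filter Topology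

variable {X : Type*} [NormedAddCommGroup X] [NormedSpace ℝ X]

theorem norm_exp_le_exp_norm (L : X →L[ℝ] X) :
    ‖NormedSpace.exp L‖ ≤ Real.exp ‖L‖ := by
  rw [NormedSpace.exp_eq_tsum ℝ, Real.exp_eq_exp_ℝ, NormedSpace.exp_eq_tsum ℝ]
  have hs : Summable fun n : ℕ => ((n.factorial : ℝ)⁻¹) • ‖L‖ ^ n :=
    NormedSpace.expSeries_summable' (𝕂 := ℝ) ‖L‖
  refine tsum_of_norm_bounded hs.hasSum fun n => ?_
  rw [norm_smul, smul_eq_mul, Real.norm_of_nonneg (by positivity)]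
  gcongr
  rcases n with _ | n
  · rw [pow_zero, pow_zero]
    exact ContinuousLinearMap.norm_id_le
  · exact norm_pow_le' L n.succ_pos

/-- A strongly continuous semigroup on `[0, ∞)`; its values at negative times only have to keep
the orbits continuous. -/
structure IsSemigroup (S : ℝ → X →L[ℝ] X) (M : ℝ) : Prop where
  zero : S 0 = 1
  add : ∀ s t, 0 ≤ s → 0 ≤ t → S (s + t) = S s * S t
  bound : ∀ t, 0 ≤ t → ‖S t‖ ≤ Real.exp (M * t)
  cont : ∀ x, Continuous fun t => S t x

theorem norm_exp_smul_apply_sub_le [CompleteSpace X] {B C : X →L[ℝ] X} {M : ℝ} (hBC : Commute B C)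
    (hB : ∀ t, 0 ≤ t → ‖NormedSpace.exp (t • B)‖ ≤ Real.exp (M * t))
    (hC : ∀ t, 0 ≤ t → ‖NormedSpace.exp (t • C)‖ ≤ Real.exp (M * t)) (x : X) {t : ℝ} (ht : 0 ≤ t) :
    ‖NormedSpace.exp (t • B) x - NormedSpace.exp (t • C) x‖ ≤
      t * Real.exp (M * t) * ‖B x - C x‖ := by
  have hd : ∀ s, HasDerivAt
      (fun s : ℝ => NormedSpace.exp ((t - s) • C) (NormedSpace.exp (s • B) x))
      (NormedSpace.exp ((t - s) • C) (NormedSpace.exp (s • B) (B x - C x))) s := by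
    intro s
    have h1 : HasDerivAt (fun s : ℝ => NormedSpace.exp ((t - s) • C))
        (-(NormedSpace.exp ((t - s) • C) * C)) s := by
      have := (hasDerivAt_exp_smul_const (𝕂 := ℝ) C (t - s)).scomp s
        ((hasDerivAt_id s).const_sub t)
      simpa [Function.comp_def] using this
    have h2 : HasDerivAt (fun s : ℝ => NormedSpace.exp (s • B) x)
        ((NormedSpace.exp (s • B) * B) x) s :=
      ((ContinuousLinearMap.apply ℝ X x).hasFDerivAt).comp_hasDerivAt s
        (hasDerivAt_exp_smul_const (𝕂 := ℝ) B s)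
    have h3 := h1.clm_apply h2
    convert h3 using 1
    have hc : C (NormedSpace.exp (s • B) x) = NormedSpace.exp (s • B) (C x) := by
      have : Commute C (NormedSpace.exp (s • B)) := (hBC.symm.smul_right s).exp_right
      exact congrArg (fun T : X →L[ℝ] X => T x) this.eq
    change _ = -(NormedSpace.exp ((t - s) • C) (C (NormedSpace.exp (s • B) x))) +
      NormedSpace.exp ((t - s) • C) (NormedSpace.exp (s • B) (B x))
    rw [hc, map_sub, map_sub, neg_add_eq_sub]
  have hb : ∀ s ∈ Ico (0 : ℝ) t,
      ‖NormedSpace.exp ((t - s) • C) (NormedSpace.exp (s • B) (B x - C x))‖ ≤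
        Real.exp (M * t) * ‖B x - C x‖ := by
    intro s hs
    calc _ ≤ Real.exp (M * (t - s)) * (Real.exp (M * s) * ‖B x - C x‖) := by
          refine ContinuousLinearMap.le_of_opNorm_le_of_le _ (hC _ (by linarith [hs.2])) ?_
          exact ContinuousLinearMap.le_of_opNorm_le _ (hB _ hs.1) _
      _ = _ := by rw [← mul_assoc, ← Real.exp_add]; ring_nf
  have := norm_image_sub_le_of_norm_deriv_le_segment' (f := fun s : ℝ =>
    NormedSpace.exp ((t - s) • C) (NormedSpace.exp (s • B) x))
    (fun s _ => (hd s).hasDerivWithinAt) hb t (right_mem_Icc.2 ht)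
  simp only [sub_self, zero_smul, NormedSpace.exp_zero, sub_zero,
    one_apply_eq_self] at this
  calc _ ≤ _ := this
    _ = _ := by ring

/-- Strong limits of semigroups with bounded generators. -/
theorem exists_semigroup_of_approx [CompleteSpace X] (B : ℕ → X →L[ℝ] X) {M : ℝ} (hM : 0 ≤ M)
    (hcomm : ∀ n m, Commute (B n) (B m))
    (hB : ∀ n t, 0 ≤ t → ‖NormedSpace.exp (t • B n)‖ ≤ Real.exp (M * t))
    {D : Set X} (hD : Dense D) (hBD : ∀ x ∈ D, CauchySeq fun n => B n x) :
    ∃ S : ℝ → X →L[ℝ] X, IsSemigroup S M ∧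
      ∀ t, 0 ≤ t → ∀ x, Tendsto (fun n => NormedSpace.exp (t • B n) x) atTop (𝓝 (S t x)) := by
  have huc : ∀ T : ℝ, 0 ≤ T → ∀ x, ∀ ε > 0, ∃ k, ∀ n ≥ k, ∀ m ≥ k, ∀ t ∈ Icc (0 : ℝ) T,
      ‖NormedSpace.exp (t • B n) x - NormedSpace.exp (t • B m) x‖ < ε := by
    intro T hT x ε hε
    have hK : 0 < Real.exp (M * T) := Real.exp_pos _
    obtain ⟨y, hyD, hy⟩ := Metric.dense_iff.1 hD x (ε / (4 * Real.exp (M * T))) (by positivity)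
    obtain ⟨k, hk⟩ := Metric.cauchySeq_iff.1 (hBD _ hy) (ε / (2 * (T + 1) * Real.exp (M * T)))
      (by positivity)
    refine ⟨k, fun n hn m hm t ht => ?_⟩
    have hyx : ‖x - y‖ < ε / (4 * Real.exp (M * T)) := by
      rw [← dist_eq_norm, dist_comm]
      exact hyD
    have hexp : Real.exp (M * t) ≤ Real.exp (M * T) := by
      gcongr
      exact ht.2
    have h1 : ∀ n, ‖NormedSpace.exp (t • B n) (x - y)‖ < ε / 4 := fun n => by
      calc _ ≤ Real.exp (M * T) * ‖x - y‖ :=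
            ContinuousLinearMap.le_of_opNorm_le _ ((hB n t ht.1).trans hexp) _
        _ < Real.exp (M * T) * (ε / (4 * Real.exp (M * T))) := by gcongr
        _ = _ := by field_simp
    have h2 : ‖NormedSpace.exp (t • B n) y - NormedSpace.exp (t • B m) y‖ ≤ ε / 2 := by
      calc _ ≤ t * Real.exp (M * t) * ‖B n y - B m y‖ :=
            norm_exp_smul_apply_sub_le (hcomm n m) (hB n) (hB m) y ht.1
        _ ≤ (T + 1) * Real.exp (M * T) * (ε / (2 * (T + 1) * Real.exp (M * T))) := by
            have := (hk n hn m hm).le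
            rw [dist_eq_norm] at this
            gcongr
            linarith [ht.2]
        _ = _ := by field_simp
    have : NormedSpace.exp (t • B n) x - NormedSpace.exp (t • B m) x =
        NormedSpace.exp (t • B n) (x - y) - NormedSpace.exp (t • B m) (x - y) +
        (NormedSpace.exp (t • B n) y - NormedSpace.exp (t • B m) y) := by
      simp only [map_sub]; abel
    rw [this]
    calc _ ≤ ‖NormedSpace.exp (t • B n) (x - y)‖ + ‖NormedSpace.exp (t • B m) (x - y)‖ +
        ‖NormedSpace.exp (t • B n) y - NormedSpace.exp (t • B m) y‖ :=
          (norm_add_le _ _).trans (by gcongr; exact norm_sub_le _ _)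
      _ < _ := by linarith [h1 n, h1 m]
  have hlim : ∀ (t : ℝ) x, ∃ y, 0 ≤ t → Tendsto (fun n => NormedSpace.exp (t • B n) x) atTop (𝓝 y) := by
    intro t x
    by_cases ht : 0 ≤ t
    · have : CauchySeq fun n => NormedSpace.exp (t • B n) x := by
        rw [Metric.cauchySeq_iff]
        intro ε hε
        obtain ⟨k, hk⟩ := huc t ht x ε hε
        exact ⟨k, fun n hn m hm => by
          rw [dist_eq_norm]; exact hk n hn m hm t (right_mem_Icc.2 ht)⟩
      obtain ⟨y, hy⟩ := cauchySeq_tendsto_of_complete this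
      exact ⟨y, fun _ => hy⟩
    · exact ⟨0, fun h => absurd h ht⟩
  choose s hs using hlim
  have hsb : ∀ t : ℝ, 0 ≤ t → ∀ x, ‖s t x‖ ≤ Real.exp (M * t) * ‖x‖ := fun t ht x =>
    le_of_tendsto (hs t x ht).norm (Eventually.of_forall fun n =>
      ContinuousLinearMap.le_of_opNorm_le _ (hB n t ht) x)
  have hS : ∀ t : ℝ, ∃ L : X →L[ℝ] X, 0 ≤ t → ∀ x, L x = s t x := by
    intro t
    by_cases ht : 0 ≤ t
    · refine ⟨LinearMap.mkContinuous ⟨⟨s t, fun x y => ?_⟩, fun c x => ?_⟩ _ (hsb t ht),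
        fun _ x => rfl⟩
      · refine tendsto_nhds_unique (hs t (x + y) ht) ?_
        simpa only [map_add] using (hs t x ht).add (hs t y ht)
      · refine tendsto_nhds_unique (hs t (c • x) ht) ?_
        simpa only [map_smul, RingHom.id_apply] using (hs t x ht).const_smul c
    · exact ⟨0, fun h => absurd h ht⟩
  choose S hSs using hS
  have hlim' : ∀ t : ℝ, 0 ≤ t → ∀ x,
      Tendsto (fun n => NormedSpace.exp (t • B n) x) atTop (𝓝 (S t x)) := by
    intro t ht x
    rw [hSs t ht]
    exact hs t x ht
  have hpos : ∀ t : ℝ, 0 ≤ t → S (max t 0) = S t := fun t ht => by rw [max_eq_left ht]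
  refine ⟨fun t => S (max t 0), ⟨?_, fun a b ha hb => ?_, fun t ht => ?_, fun x => ?_⟩,
    fun t ht x => by simpa only [hpos t ht] using hlim' t ht x⟩
  · rw [hpos 0 le_rfl]
    ext x
    refine tendsto_nhds_unique (hlim' 0 le_rfl x) ?_
    simp
  · rw [hpos _ (add_nonneg ha hb), hpos a ha, hpos b hb]
    ext x
    refine tendsto_nhds_unique (hlim' _ (add_nonneg ha hb) x) ?_
    have h1 : ∀ n, NormedSpace.exp ((a + b) • B n) x =
        NormedSpace.exp (a • B n) (NormedSpace.exp (b • B n) x - S b x) +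
          NormedSpace.exp (a • B n) (S b x) := by
      intro n
      let : NormedAlgebra ℚ (X →L[ℝ] X) := NormedAlgebra.restrictScalars ℚ ℝ _
      rw [add_smul, NormedSpace.exp_add_of_commute
        (((Commute.refl (B n)).smul_left a).smul_right b), ← map_add, sub_add_cancel]
      rfl
    simp only [h1]
    change Tendsto _ _ (𝓝 (S a (S b x)))
    rw [← zero_add (S a (S b x))]
    refine Tendsto.add ?_ (hlim' a ha _)
    have h0 : Tendsto (fun n => Real.exp (M * a) * ‖NormedSpace.exp (b • B n) x - S b x‖)
        atTop (𝓝 0) := by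
      have := ((hlim' b hb x).sub_const (S b x)).norm.const_mul (Real.exp (M * a))
      simpa using this
    exact squeeze_zero_norm (fun n => ContinuousLinearMap.le_of_opNorm_le _ (hB n a ha) _) h0
  · rw [hpos t ht]
    refine ContinuousLinearMap.opNorm_le_bound _ (Real.exp_pos _).le fun x => ?_
    rw [hSs t ht]
    exact hsb t ht x
  · have hloc : TendstoLocallyUniformlyOn (fun n t => NormedSpace.exp (t • B n) x)
        (fun t => S t x) atTop (Ici 0) := by
      rw [Metric.tendstoLocallyUniformlyOn_iff]
      intro ε hε t ht
      obtain ⟨k, hk⟩ := huc (t + 1) (by linarith [mem_Ici.1 ht]) x (ε / 2) (by positivity)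
      refine ⟨Ici 0 ∩ Iio (t + 1), inter_mem_nhdsWithin _ (Iio_mem_nhds (by linarith)), ?_⟩
      filter_upwards [eventually_ge_atTop k] with n hn r hr
      have : dist (S r x) (NormedSpace.exp (r • B n) x) ≤ ε / 2 := by
        refine le_of_tendsto ((hlim' r hr.1 x).dist tendsto_const_nhds) ?_
        filter_upwards [eventually_ge_atTop k] with m hm
        rw [dist_eq_norm]
        exact (hk m hm n hn r ⟨hr.1, (mem_Iio.1 hr.2).le⟩).le
      linarith
    refine (hloc.continuousOn (Frequently.of_forall fun n => ?_)).comp_continuous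
      (continuous_id.max continuous_const) fun t => le_max_right t 0
    have : Continuous fun t : ℝ => NormedSpace.exp (t • B n) := continuous_iff_continuousAt.2
      fun t => (hasDerivAt_exp_smul_const (𝕂 := ℝ) (B n) t).continuousAt
    exact (this.clm_apply continuous_const).continuousOn

/-- A resolvent family of a densely defined operator `A` such that `A - κ` is dissipative. -/
structure IsResolvent (R : ℝ → X →L[ℝ] X) (κ : ℝ) : Prop where
  nonneg : 0 ≤ κ
  identity : ∀ l, κ < l → ∀ m, κ < m → R l - R m = (m - l) • (R l * R m)
  bound : ∀ l, κ < l → ‖R l‖ ≤ (l - κ)⁻¹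
  dense : ∀ l, κ < l → DenseRange (R l)

/-- The semigroup `S` is generated by the operator with resolvent `R`: it commutes with `R`, and
`S(t)x - x = A ∫₀ᵗ S(s)x ds`, written through the resolvent. -/
def Generates (R : ℝ → X →L[ℝ] X) (κ : ℝ) (S : ℝ → X →L[ℝ] X) : Prop :=
  ∀ l, κ < l → ∀ t, 0 ≤ t → ∀ x, R l (S t x) = S t (R l x) ∧
    R l (S t x - x) = l • R l (∫ s in (0 : ℝ)..t, S s x) - ∫ s in (0 : ℝ)..t, S s x

namespace IsResolvent

variable {R : ℝ → X →L[ℝ] X} {κ : ℝ}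

theorem commute (h : IsResolvent R κ) {l m : ℝ} (hl : κ < l) (hm : κ < m) :
    Commute (R l) (R m) := by
  rcases eq_or_ne l m with rfl | hlm
  · exact Commute.refl _
  have h1 := h.identity l hl m hm
  have h2 := h.identity m hm l hl
  have h3 : (m - l) • (R l * R m) = (m - l) • (R m * R l) := by
    rw [← h1, ← neg_sub (R m), h2, ← neg_smul, neg_sub]
  exact smul_right_injective _ (sub_ne_zero.2 hlm.symm) h3

/-- The Yosida approximation of the generator. -/
def yosida (R : ℝ → X →L[ℝ] X) (l : ℝ) : X →L[ℝ] X := (l ^ 2) • R l - l • 1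

theorem commute_yosida (h : IsResolvent R κ) {l m : ℝ} (hl : κ < l) (hm : κ < m) :
    Commute (R l) (yosida R m) :=
  ((h.commute hl hm).smul_right _).sub_right ((Commute.one_right _).smul_right _)

theorem yosida_commute_yosida (h : IsResolvent R κ) {l m : ℝ} (hl : κ < l) (hm : κ < m) :
    Commute (yosida R l) (yosida R m) :=
  ((h.commute_yosida hl hm).smul_left _).sub_left ((Commute.one_left _).smul_left _)

theorem smul_apply_apply (h : IsResolvent R κ) {l m : ℝ} (hl : κ < l) (hm : κ < m) (x : X) :
    m • R m (R l x) - R l x = R m (l • R l x - x) := by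
  have := congrArg (fun T : X →L[ℝ] X => T x) (h.identity m hm l hl)
  change R m x - R l x = (l - m) • R m (R l x) at this
  rw [map_sub, map_smul, sub_eq_sub_iff_add_eq_add, ← sub_eq_sub_iff_add_eq_add]
  rw [sub_smul] at this
  rw [eq_sub_iff_add_eq] at this
  rw [← this]
  abel

theorem apply_yosida (h : IsResolvent R κ) {l m : ℝ} (hl : κ < l) (hm : κ < m) (x : X) :
    R l (yosida R m x) = m • R m (l • R l x - x) := by
  have h1 : R l (yosida R m x) = yosida R m (R l x) :=
    congrArg (fun T : X →L[ℝ] X => T x) (h.commute_yosida hl hm).eq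
  rw [h1, ← h.smul_apply_apply hl hm]
  change (m ^ 2) • R m (R l x) - m • R l x = _
  rw [smul_sub, smul_smul, sq]

theorem norm_smul_le (h : IsResolvent R κ) {l : ℝ} (hl : 2 * κ < l) : ‖l • R l‖ ≤ 2 := by
  have h0 := h.nonneg
  have hl' : κ < l := by linarith
  rw [norm_smul, Real.norm_of_nonneg (by linarith)]
  calc l * ‖R l‖ ≤ l * (l - κ)⁻¹ := by
        gcongr
        · linarith
        · exact h.bound l hl'
    _ ≤ 2 := by
        rw [← div_eq_mul_inv, div_le_iff₀ (by linarith)]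
        linarith

theorem tendsto_smul (h : IsResolvent R κ) (x : X) :
    Tendsto (fun l : ℝ => l • R l x) atTop (𝓝 x) := by
  have h0 := h.nonneg
  rw [Metric.tendsto_atTop']
  intro ε hε
  obtain ⟨y, hy⟩ := (h.dense (κ + 1) (by linarith)).exists_dist_lt x
    (show 0 < ε / 6 by positivity)
  set z := R (κ + 1) y
  set C := ‖(κ + 1) • z - y‖
  refine ⟨2 * κ + 2 * C / ε + 1, fun l hl => ?_⟩
  have hC : 0 ≤ C := norm_nonneg _
  have hq : 0 ≤ 2 * C / ε := by positivity
  have hl1 : 2 * κ < l := by linarith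
  have hl2 : κ < l := by linarith
  have h1 : ‖l • R l (x - z)‖ ≤ 2 * ‖x - z‖ :=
    ContinuousLinearMap.le_of_opNorm_le (l • R l) (h.norm_smul_le hl1) _
  have h2 : ‖l • R l z - z‖ ≤ ε / 2 := by
    rw [h.smul_apply_apply (by linarith) hl2]
    calc _ ≤ (l - κ)⁻¹ * C := ContinuousLinearMap.le_of_opNorm_le _ (h.bound l hl2) _
      _ ≤ ε / 2 := by
        rw [inv_mul_le_iff₀ (by linarith)]
        have : 2 * C / ε ≤ l - κ := by linarith
        rw [div_le_iff₀ hε] at this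
        linarith
  rw [dist_eq_norm] at hy ⊢
  have : l • R l x - x = l • R l (x - z) + (l • R l z - z) - (x - z) := by
    rw [map_sub, smul_sub]; abel
  rw [this]
  calc _ ≤ ‖l • R l (x - z)‖ + ‖l • R l z - z‖ + ‖x - z‖ :=
        (norm_sub_le _ _).trans (by gcongr; exact norm_add_le _ _)
    _ < ε := by linarith

theorem norm_exp_yosida_le [CompleteSpace X] (h : IsResolvent R κ) {l : ℝ} (hl : 2 * κ < l)
    {t : ℝ} (ht : 0 ≤ t) : ‖NormedSpace.exp (t • yosida R l)‖ ≤ Real.exp (2 * κ * t) := by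
  have h0 := h.nonneg
  have hl' : κ < l := by linarith
  have he : t • yosida R l = (t * l ^ 2) • R l + algebraMap ℝ (X →L[ℝ] X) (-(t * l)) := by
    rw [yosida, smul_sub, smul_smul, smul_smul, sub_eq_add_neg, ← neg_smul,
      Algebra.algebraMap_eq_smul_one]
  let : NormedAlgebra ℚ (X →L[ℝ] X) := NormedAlgebra.restrictScalars ℚ ℝ _
  rw [he, NormedSpace.exp_add_of_commute (Algebra.commutes _ _).symm,
    ← NormedSpace.algebraMap_exp_comm, Algebra.algebraMap_eq_smul_one, mul_smul_comm, mul_one,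
    norm_smul, ← Real.exp_eq_exp_ℝ, Real.norm_of_nonneg (Real.exp_pos _).le]
  calc _ ≤ Real.exp (-(t * l)) * Real.exp (‖(t * l ^ 2) • R l‖) := by
        gcongr
        exact norm_exp_le_exp_norm _
    _ = Real.exp (-(t * l) + ‖(t * l ^ 2) • R l‖) := (Real.exp_add _ _).symm
    _ ≤ _ := by
        refine Real.exp_le_exp.2 ?_
        rw [norm_smul, Real.norm_of_nonneg (by positivity)]
        have h1 : (t * l ^ 2) * ‖R l‖ ≤ (t * l ^ 2) * (l - κ)⁻¹ := by
          gcongr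
          exact h.bound l hl'
        have h2 : l ^ 2 * (l - κ)⁻¹ ≤ l + 2 * κ := by
          rw [← div_eq_mul_inv, div_le_iff₀ (by linarith)]
          nlinarith
        nlinarith

/-- The Hille–Yosida theorem. -/
theorem exists_semigroup [CompleteSpace X] (h : IsResolvent R κ) :
    ∃ S : ℝ → X →L[ℝ] X, IsSemigroup S (2 * κ) ∧ Generates R κ S := by
  have h0 := h.nonneg
  set ν : ℕ → ℝ := fun n => 2 * κ + 1 + n with hν
  have hν2 : ∀ n, 2 * κ < ν n := fun n => by
    have : (0 : ℝ) ≤ n := n.cast_nonneg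
    simp only [hν]; linarith
  have hν1 : ∀ n, κ < ν n := fun n => by linarith [hν2 n]
  have hνt : Tendsto ν atTop atTop := tendsto_atTop_add_const_left _ _ tendsto_natCast_atTop_atTop
  have hyos : ∀ n y, yosida R (ν n) (R (κ + 1) y) =
      ν n • R (ν n) ((κ + 1) • R (κ + 1) y - y) := by
    intro n y
    rw [← h.apply_yosida (by linarith) (hν1 n)]
    exact (congrArg (fun T : X →L[ℝ] X => T y) (h.commute_yosida (by linarith) (hν1 n)).eq).symm
  obtain ⟨S, hS, hlim⟩ := exists_semigroup_of_approx (fun n => yosida R (ν n))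
    (M := 2 * κ) (by linarith)
    (fun n m => h.yosida_commute_yosida (hν1 n) (hν1 m))
    (fun n t ht => h.norm_exp_yosida_le (hν2 n) ht) (h.dense (κ + 1) (by linarith))
    (by
      rintro _ ⟨y, rfl⟩
      simp only [hyos]
      exact ((h.tendsto_smul _).comp hνt).cauchySeq)
  have hRS : ∀ l, κ < l → ∀ t, 0 ≤ t → ∀ x, R l (S t x) = S t (R l x) := by
    intro l hl t ht x
    refine tendsto_nhds_unique (((R l).continuous.tendsto _).comp (hlim t ht x)) ?_
    convert hlim t ht (R l x) using 2 with n
    exact congrArg (fun T : X →L[ℝ] X => T x)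
      ((h.commute_yosida hl (hν1 n)).smul_right t).exp_right.eq
  refine ⟨S, hS, fun l hl t ht x => ⟨hRS l hl t ht x, ?_⟩⟩
  set w := l • R l x - x with hw
  have hwn : Tendsto (fun n => ν n • R (ν n) w) atTop (𝓝 w) := (h.tendsto_smul w).comp hνt
  have hwb : ∀ n, ‖ν n • R (ν n) w‖ ≤ 2 * ‖w‖ := fun n =>
    ContinuousLinearMap.le_of_opNorm_le (ν n • R (ν n)) (h.norm_smul_le (hν2 n)) _
  have hcexp : ∀ n y, Continuous fun s : ℝ => NormedSpace.exp (s • yosida R (ν n)) y := by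
    intro n y
    have : Continuous fun t : ℝ => NormedSpace.exp (t • yosida R (ν n)) :=
      continuous_iff_continuousAt.2
        fun t => (hasDerivAt_exp_smul_const (𝕂 := ℝ) (yosida R (ν n)) t).continuousAt
    exact this.clm_apply continuous_const
  have hint : ∀ n, ∫ s in (0 : ℝ)..t, NormedSpace.exp (s • yosida R (ν n)) (ν n • R (ν n) w) =
      R l (NormedSpace.exp (t • yosida R (ν n)) x) - R l x := by
    intro n
    have hd : ∀ s : ℝ, HasDerivAt (fun s : ℝ => R l (NormedSpace.exp (s • yosida R (ν n)) x))
        (NormedSpace.exp (s • yosida R (ν n)) (ν n • R (ν n) w)) s := by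
      intro s
      have h2 := (((R l).comp (ContinuousLinearMap.apply ℝ X x)).hasFDerivAt).comp_hasDerivAt s
        (hasDerivAt_exp_smul_const (𝕂 := ℝ) (yosida R (ν n)) s)
      have h3 : NormedSpace.exp (s • yosida R (ν n)) (ν n • R (ν n) w) =
          R l (NormedSpace.exp (s • yosida R (ν n)) (yosida R (ν n) x)) := by
        rw [hw, ← h.apply_yosida hl (hν1 n)]
        exact (congrArg (fun T : X →L[ℝ] X => T (yosida R (ν n) x))
          ((h.commute_yosida hl (hν1 n)).smul_right s).exp_right.eq).symm
      rw [h3]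
      exact h2
    rw [intervalIntegral.integral_eq_sub_of_hasDerivAt (fun s _ => hd s)
      ((hcexp n _).intervalIntegrable _ _)]
    simp
  have hI : IntervalIntegrable (fun s => S s x) volume 0 t :=
    (hS.cont x).intervalIntegrable _ _
  have hRI : IntervalIntegrable (fun s => R l (S s x)) volume 0 t :=
    ⟨(R l).integrable_comp hI.1, (R l).integrable_comp hI.2⟩
  have hrhs : ∫ s in (0 : ℝ)..t, S s w =
      l • R l (∫ s in (0 : ℝ)..t, S s x) - ∫ s in (0 : ℝ)..t, S s x := by
    rw [← (R l).intervalIntegral_comp_comm hI, ← intervalIntegral.integral_smul,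
      ← intervalIntegral.integral_sub (f := fun s => l • R l (S s x)) (hRI.smul l) hI]
    · refine intervalIntegral.integral_congr fun s hs => ?_
      rw [uIcc_of_le ht] at hs
      simp only [hw, map_sub, map_smul, hRS l hl s hs.1 x]
  rw [← hrhs, map_sub]
  have hL : Tendsto (fun n => R l (NormedSpace.exp (t • yosida R (ν n)) x) - R l x) atTop
      (𝓝 (R l (S t x) - R l x)) :=
    ((((R l).continuous.tendsto _).comp (hlim t ht x))).sub_const _
  refine tendsto_nhds_unique hL ?_
  simp only [← hint]
  refine intervalIntegral.tendsto_integral_filter_of_dominated_convergence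
    (fun _ => Real.exp (2 * κ * t) * (2 * ‖w‖)) ?_ ?_ ?_ ?_
  · exact Eventually.of_forall fun n => (hcexp n _).aestronglyMeasurable
  · refine Eventually.of_forall fun n => ae_of_all _ fun s hs => ?_
    rw [uIoc_of_le ht] at hs
    refine ContinuousLinearMap.le_of_opNorm_le_of_le _ ?_ (hwb n)
    refine (h.norm_exp_yosida_le (hν2 n) hs.1.le).trans ?_
    gcongr
    exact hs.2
  · exact intervalIntegrable_const
  · refine ae_of_all _ fun s hs => ?_
    rw [uIoc_of_le ht] at hs
    have h1 : Tendsto (fun n => NormedSpace.exp (s • yosida R (ν n)) (ν n • R (ν n) w - w))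
        atTop (𝓝 0) := by
      refine squeeze_zero_norm (a := fun n => Real.exp (2 * κ * s) * ‖ν n • R (ν n) w - w‖)
        (fun n => ContinuousLinearMap.le_of_opNorm_le _ (h.norm_exp_yosida_le (hν2 n) hs.1.le) _) ?_
      simpa using ((hwn.sub_const w).norm).const_mul (Real.exp (2 * κ * s))
    have h2 := h1.add (hlim s hs.1.le w)
    rw [zero_add] at h2
    refine h2.congr fun n => ?_
    rw [map_sub, sub_add_cancel]

/-- On the domain of the generator the orbits are continuously differentiable. -/
theorem exists_contDiff_orbit [CompleteSpace X] {S : ℝ → X →L[ℝ] X} {M : ℝ} (hS : IsSemigroup S M)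
    (hg : Generates R κ S) {l : ℝ} (hl : κ < l) (x : X) :
    ∃ F : ℝ → X, ContDiff ℝ 1 F ∧ (∀ t, 0 ≤ t → F t = R l (S t x)) ∧
      ∀ t, HasDerivAt F (l • R l (S t x) - S t x) t := by
  have hRc : Continuous fun s => R l (S s x) := (R l).continuous.comp (hS.cont x)
  have hc : Continuous fun s => l • R l (S s x) - S s x := (hRc.const_smul l).sub (hS.cont x)
  have hd : ∀ t, HasDerivAt (fun t => R l x + ∫ s in (0 : ℝ)..t, (l • R l (S s x) - S s x))
      (l • R l (S t x) - S t x) t := fun t =>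
    (hc.integral_hasStrictDerivAt 0 t).hasDerivAt.const_add _
  refine ⟨_, ?_, fun t ht => ?_, hd⟩
  · rw [contDiff_one_iff_deriv]
    refine ⟨fun t => (hd t).differentiableAt, ?_⟩
    rw [funext fun t => (hd t).deriv]
    exact hc
  · have h1 := (hg l hl t ht x).2
    rw [map_sub, sub_eq_iff_eq_add'] at h1
    rw [h1, intervalIntegral.integral_sub (f := fun s => l • R l (S s x))
      ((hRc.const_smul l).intervalIntegrable _ _) ((hS.cont x).intervalIntegrable _ _),
      intervalIntegral.integral_smul, (R l).intervalIntegral_comp_comm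
      ((hS.cont x).intervalIntegrable _ _)]

end IsResolvent
end HilleYosida

namespace Dirichlet

open Filter Topology HilleYosida

variable {H V W : Type*} [NormedAddCommGroup H] [InnerProductSpace ℝ H]
  [NormedAddCommGroup V] [InnerProductSpace ℝ V] [NormedAddCommGroup W] [NormedSpace ℝ W]

/-- The properties of the maps `val : H₀¹ → L²`, `grad : H₀¹ → L²`, `incl : H₀¹ ∩ H² → H₀¹` and
`hess : H₀¹ ∩ H² → L²` on which the theory of the Dirichlet problem rests. -/
structure IsSetting (val grad : V →L[ℝ] H) (incl : W →L[ℝ] V) (hess : W →L[ℝ] H) : Prop where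
  norm_sq : ∀ u, ‖u‖ ^ 2 = ‖val u‖ ^ 2 + ‖grad u‖ ^ 2
  val_injective : Function.Injective val
  incl_injective : Function.Injective incl
  inner_val_grad : ∀ u, inner ℝ (val u) (grad u) = 0
  inner_hess_val : ∀ u w, inner ℝ (hess u) (val w) = - inner ℝ (grad (incl u)) (grad w)
  regular : ∀ u g, (∀ w, inner ℝ (grad u) (grad w) = - inner ℝ g (val w)) →
    ∃ w, incl w = u ∧ hess w = g
  dense_domain : DenseRange fun u => val (incl u)
  dense_smooth : Dense {u | ∃ w, incl w = u ∧ grad u ∈ range val ∧ hess w ∈ range val}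

variable {val grad : V →L[ℝ] H} {incl : W →L[ℝ] V} {hess : W →L[ℝ] H}

/-! ### The advection–diffusion operator and its resolvent -/

/-- The operator `u ↦ c u' + D u''` with Dirichlet condition. -/
def advDiffL (grad : V →L[ℝ] H) (incl : W →L[ℝ] V) (hess : W →L[ℝ] H) (c D : ℝ) : W →L[ℝ] H :=
  c • grad.comp incl + D • hess

/-- The resolvent of `advDiffL`, with values in its domain. -/
def IsDomainResolvent (val grad : V →L[ℝ] H) (incl : W →L[ℝ] V) (hess : W →L[ℝ] H) (c D : ℝ)
    (T : ℝ → H →L[ℝ] W) : Prop :=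
  ∀ l, 0 < l → (∀ f, l • val (incl (T l f)) - advDiffL grad incl hess c D (T l f) = f) ∧
    ∀ u, T l (l • val (incl u) - advDiffL grad incl hess c D u) = u

variable {c D : ℝ}

theorem advDiffL_apply (c D : ℝ) (u : W) :
    advDiffL grad incl hess c D u = c • grad (incl u) + D • hess u := rfl

theorem inner_advDiffL_val (hs : IsSetting val grad incl hess) (u : W) (w : V) : inner ℝ (advDiffL grad incl hess c D u) (val w) =
    c * inner ℝ (grad (incl u)) (val w) - D * inner ℝ (grad (incl u)) (grad w) := by
  rw [advDiffL_apply, inner_add_left, real_inner_smul_left, real_inner_smul_left, hs.inner_hess_val]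
  ring

theorem inner_advDiffL_self (hs : IsSetting val grad incl hess) (u : W) :
    inner ℝ (advDiffL grad incl hess c D u) (val (incl u)) = - (D * ‖grad (incl u)‖ ^ 2) := by
  rw [inner_advDiffL_val hs, real_inner_comm, hs.inner_val_grad, real_inner_self_eq_norm_sq]
  ring

theorem inner_smul_sub_advDiffL_self (hs : IsSetting val grad incl hess) (l : ℝ) (u : W) :
    inner ℝ (l • val (incl u) - advDiffL grad incl hess c D u) (val (incl u)) =
      l * ‖val (incl u)‖ ^ 2 + D * ‖grad (incl u)‖ ^ 2 := by
  rw [inner_sub_left, inner_advDiffL_self hs, real_inner_smul_left, real_inner_self_eq_norm_sq]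
  ring

theorem norm_val_le (hs : IsSetting val grad incl hess) (hD : 0 ≤ D) {l : ℝ} (hl : 0 < l) (u : W) :
    ‖val (incl u)‖ ≤ l⁻¹ * ‖l • val (incl u) - advDiffL grad incl hess c D u‖ := by
  have h1 := inner_smul_sub_advDiffL_self (c := c) (D := D) hs l u
  have h2 := real_inner_le_norm (l • val (incl u) - advDiffL grad incl hess c D u) (val (incl u))
  have h3 : 0 ≤ D * ‖grad (incl u)‖ ^ 2 := by positivity
  rw [← div_eq_inv_mul, le_div_iff₀ hl]
  rcases (norm_nonneg (val (incl u))).eq_or_lt with h0 | h0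
  · rw [← h0, zero_mul]; positivity
  · refine le_of_mul_le_mul_right ?_ h0
    nlinarith

/-- The resolvent estimate in `H¹`: pair the equation with `-u''`. -/
theorem norm_grad_le (hs : IsSetting val grad incl hess) (hD : 0 < D) {l : ℝ} (hl : c ^ 2 / (4 * D) < l) (u : W) (f : V)
    (hf : l • val (incl u) - advDiffL grad incl hess c D u = val f) :
    ‖grad (incl u)‖ ≤ (l - c ^ 2 / (4 * D))⁻¹ * ‖grad f‖ := by
  have h1 : inner ℝ (hess u) (l • val (incl u) - advDiffL grad incl hess c D u) =
      - inner ℝ (grad (incl u)) (grad f) := by rw [hf, hs.inner_hess_val]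
  rw [inner_sub_right, real_inner_smul_right, hs.inner_hess_val, advDiffL_apply, inner_add_right,
    real_inner_smul_right, real_inner_smul_right, real_inner_self_eq_norm_sq,
    real_inner_self_eq_norm_sq] at h1
  have h2 := real_inner_le_norm (grad (incl u)) (grad f)
  have h4 : - (c * inner ℝ (hess u) (grad (incl u))) ≤
      |c| * (‖hess u‖ * ‖grad (incl u)‖) := by
    calc _ ≤ |c * inner ℝ (hess u) (grad (incl u))| := neg_le_abs _
      _ ≤ _ := by
        rw [abs_mul]
        gcongr
        exact abs_real_inner_le_norm _ _
  have h5 : |c| * (‖hess u‖ * ‖grad (incl u)‖) ≤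
      D * ‖hess u‖ ^ 2 + c ^ 2 / (4 * D) * ‖grad (incl u)‖ ^ 2 := by
    have h6 : 0 ≤ D * (‖hess u‖ - |c| / (2 * D) * ‖grad (incl u)‖) ^ 2 := by positivity
    have h7 : D * (‖hess u‖ - |c| / (2 * D) * ‖grad (incl u)‖) ^ 2 =
        D * ‖hess u‖ ^ 2 + |c| ^ 2 / (4 * D) * ‖grad (incl u)‖ ^ 2 -
          |c| * (‖hess u‖ * ‖grad (incl u)‖) := by field_simp; ring
    rw [sq_abs] at h7
    linarith
  rw [← div_eq_inv_mul, le_div_iff₀ (by linarith)]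
  rcases (norm_nonneg (grad (incl u))).eq_or_lt with h0 | h0
  · rw [← h0, zero_mul]; positivity
  · refine le_of_mul_le_mul_right ?_ h0
    nlinarith

theorem smul_sub_advDiffL_injective (hs : IsSetting val grad incl hess) (hD : 0 ≤ D) {l : ℝ} (hl : 0 < l) :
    Function.Injective (l • val.comp incl - advDiffL grad incl hess c D) := by
  rw [injective_iff_map_eq_zero]
  intro u hu
  have h := norm_val_le (c := c) hs hD hl u
  have hu' : l • val (incl u) - advDiffL grad incl hess c D u = 0 := hu
  rw [hu', norm_zero, mul_zero] at h
  refine hs.incl_injective (hs.val_injective ?_)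
  rw [map_zero, map_zero]
  exact norm_le_zero_iff.1 h

/-- The bilinear form on `H₀¹(ℝ₊)` of the resolvent problem. -/
def resolventForm (val grad : V →L[ℝ] H) (c D l : ℝ) : V →L[ℝ] V →L[ℝ] ℝ :=
  (innerSL ℝ).bilinearComp (l • val - c • grad) val + D • (innerSL ℝ).bilinearComp grad grad

theorem resolventForm_apply (l : ℝ) (u w : V) : resolventForm val grad c D l u w =
    inner ℝ (l • val u - c • grad u) (val w) + D * inner ℝ (grad u) (grad w) := rfl

theorem isCoercive_resolventForm (hs : IsSetting val grad incl hess) (hD : 0 < D) {l : ℝ} (hl : 0 < l) :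
    IsCoercive (resolventForm val grad c D l) := by
  refine ⟨min l D, lt_min hl hD, fun u => ?_⟩
  rw [resolventForm_apply, inner_sub_left, real_inner_smul_left, real_inner_smul_left,
    real_inner_comm (val u) (grad u), hs.inner_val_grad, real_inner_self_eq_norm_sq,
    real_inner_self_eq_norm_sq, mul_assoc, ← sq, hs.norm_sq]
  have h1 := mul_le_mul_of_nonneg_right (min_le_left l D) (sq_nonneg ‖val u‖)
  have h2 := mul_le_mul_of_nonneg_right (min_le_right l D) (sq_nonneg ‖grad u‖)
  linarith

theorem smul_sub_advDiffL_surjective [CompleteSpace H] [CompleteSpace V]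
    (hs : IsSetting val grad incl hess) (hD : 0 < D) {l : ℝ} (hl : 0 < l) :
    Function.Surjective (l • val.comp incl - advDiffL grad incl hess c D) := by
  intro f
  set E := (isCoercive_resolventForm (c := c) hs hD hl).continuousLinearEquivOfBilin
  set u : V := E.symm (ContinuousLinearMap.adjoint val f)
  have hu : ∀ w, inner ℝ (l • val u - c • grad u) (val w) + D * inner ℝ (grad u) (grad w) =
      inner ℝ f (val w) := by
    intro w
    rw [← resolventForm_apply,
      ← (isCoercive_resolventForm (c := c) hs hD hl).continuousLinearEquivOfBilin_apply,
      ContinuousLinearEquiv.apply_symm_apply, ContinuousLinearMap.adjoint_inner_left]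
  obtain ⟨w, hw, hw'⟩ := hs.regular u (D⁻¹ • (l • val u - c • grad u - f)) fun w => by
    have := hu w
    rw [real_inner_smul_left, inner_sub_left, ← this]
    field_simp
    ring
  refine ⟨w, ?_⟩
  change l • val (incl w) - (c • grad (incl w) + D • hess w) = f
  rw [hw, hw', smul_smul, mul_inv_cancel₀ hD.ne', one_smul]
  abel

theorem exists_isDomainResolvent [CompleteSpace H] [CompleteSpace V] [CompleteSpace W]
    (hs : IsSetting val grad incl hess) (hD : 0 < D) :
    ∃ T, IsDomainResolvent val grad incl hess c D T := by
  have : ∀ l : ℝ, ∃ T : H →L[ℝ] W, 0 < l →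
      (∀ f, l • val (incl (T f)) - advDiffL grad incl hess c D (T f) = f) ∧
      ∀ u, T (l • val (incl u) - advDiffL grad incl hess c D u) = u := by
    intro l
    by_cases hl : 0 < l
    · let E := ContinuousLinearEquiv.ofBijective (l • val.comp incl - advDiffL grad incl hess c D)
        (LinearMap.ker_eq_bot.2 (smul_sub_advDiffL_injective hs hD.le hl))
        (LinearMap.range_eq_top.2 (smul_sub_advDiffL_surjective hs hD hl))
      exact ⟨E.symm, fun _ => ⟨fun f => E.apply_symm_apply f, fun u => E.symm_apply_apply u⟩⟩
    · exact ⟨0, fun h => absurd h hl⟩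
  choose T hT using this
  exact ⟨T, hT⟩

theorem IsDomainResolvent.advDiffL_apply {T : ℝ → H →L[ℝ] W}
    (hT : IsDomainResolvent val grad incl hess c D T) {l : ℝ} (hl : 0 < l) (f : H) :
    advDiffL grad incl hess c D (T l f) = l • val (incl (T l f)) - f := by
  rw [eq_sub_iff_add_eq, ← eq_sub_iff_add_eq', (hT l hl).1]

theorem resolvent_identity {T : ℝ → H →L[ℝ] W}
    (hT : IsDomainResolvent val grad incl hess c D T) {l m : ℝ} (hl : 0 < l) (hm : 0 < m)
    (f : H) : T l f - T m f = (m - l) • T l (val (incl (T m f))) := by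
  have h1 := (hT m hm).1 f
  have h2 : f - (l • val (incl (T m f)) - advDiffL grad incl hess c D (T m f)) =
      (m - l) • val (incl (T m f)) := by
    nth_rewrite 1 [← h1]
    rw [sub_smul]
    abel
  have h3 := congrArg (T l) h2
  rwa [map_sub, (hT l hl).2, map_smul] at h3

theorem isResolvent_val (hs : IsSetting val grad incl hess) (hD : 0 < D) {T : ℝ → H →L[ℝ] W}
    (hT : IsDomainResolvent val grad incl hess c D T) :
    IsResolvent (fun l => (val.comp incl).comp (T l)) (c ^ 2 / (4 * D)) := by
  have h0 : 0 ≤ c ^ 2 / (4 * D) := by positivity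
  refine ⟨h0, fun l hl m hm => ?_, fun l hl => ?_, fun l hl => ?_⟩
  · ext1 f
    change val (incl (T l f)) - val (incl (T m f)) = (m - l) • val (incl (T l (val (incl (T m f)))))
    rw [← map_sub, ← map_sub, resolvent_identity hT (by linarith) (by linarith), map_smul, map_smul]
  · have hl0 : 0 < l := by linarith
    refine ContinuousLinearMap.opNorm_le_bound _ (inv_nonneg.2 (by linarith)) fun f => ?_
    have h1 := norm_val_le (c := c) hs hD.le hl0 (T l f)
    rw [(hT l hl0).1] at h1
    refine h1.trans ?_
    gcongr
    linarith
  · have hl0 : 0 < l := by linarith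
    refine (hs.dense_domain).mono ?_
    rintro _ ⟨u, rfl⟩
    exact ⟨_, congrArg (fun u => val (incl u)) ((hT l hl0).2 u)⟩

theorem isResolvent_incl (hs : IsSetting val grad incl hess) (hD : 0 < D) {T : ℝ → H →L[ℝ] W}
    (hT : IsDomainResolvent val grad incl hess c D T) :
    IsResolvent (fun l => (incl.comp (T l)).comp val) (c ^ 2 / (4 * D)) := by
  have h0 : 0 ≤ c ^ 2 / (4 * D) := by positivity
  refine ⟨h0, fun l hl m hm => ?_, fun l hl => ?_, fun l hl => ?_⟩
  · ext1 f
    change incl (T l (val f)) - incl (T m (val f)) = (m - l) • incl (T l (val (incl (T m (val f)))))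
    rw [← map_sub, resolvent_identity hT (by linarith) (by linarith), map_smul]
  · have hl0 : 0 < l := by linarith
    have hl1 : 0 ≤ (l - c ^ 2 / (4 * D))⁻¹ := inv_nonneg.2 (by linarith)
    refine ContinuousLinearMap.opNorm_le_bound _ hl1 fun f => ?_
    change ‖incl (T l (val f))‖ ≤ _
    have h1 := norm_val_le (c := c) hs hD.le hl0 (T l (val f))
    rw [(hT l hl0).1] at h1
    have h2 := norm_grad_le hs hD hl (T l (val f)) f ((hT l hl0).1 _)
    have h3 : l⁻¹ * ‖val f‖ ≤ (l - c ^ 2 / (4 * D))⁻¹ * ‖val f‖ := by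
      gcongr
      linarith
    refine le_of_sq_le_sq ?_ (by positivity)
    rw [hs.norm_sq, mul_pow, hs.norm_sq, mul_add, ← mul_pow, ← mul_pow]
    gcongr
    exact h1.trans h3
  · have hl0 : 0 < l := by linarith
    refine hs.dense_smooth.mono ?_
    rintro u ⟨w, rfl, ⟨p, hp⟩, ⟨q, hq⟩⟩
    refine ⟨l • incl w - (c • p + D • q), ?_⟩
    change incl (T l (val (l • incl w - (c • p + D • q)))) = incl w
    rw [map_sub, map_add, map_smul, map_smul, map_smul, hp, hq, ← advDiffL_apply, (hT l hl0).2]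

/-! ### The Cauchy problem -/

/-- Mild solutions of `v' = A v`, `v(0) = f`. -/
def IsMild (val grad : V →L[ℝ] H) (incl : W →L[ℝ] V) (hess : W →L[ℝ] H) (c D : ℝ) (f : H)
    (v : ℝ → H) : Prop :=
  ∀ t, 0 ≤ t → ∃ U : W, val (incl U) = ∫ s in (0 : ℝ)..t, v s ∧
    v t = f + advDiffL grad incl hess c D U

theorem IsMild.congr {f : H} {v v' : ℝ → H} (h : IsMild val grad incl hess c D f v)
    (hv : ∀ t, 0 ≤ t → v t = v' t) : IsMild val grad incl hess c D f v' := by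
  intro t ht
  obtain ⟨U, h1, h2⟩ := h t ht
  refine ⟨U, ?_, by rw [← hv t ht, h2]⟩
  rw [h1]
  refine intervalIntegral.integral_congr fun s hs => ?_
  rw [uIcc_of_le ht] at hs
  exact hv s hs.1

theorem antitoneOn_norm_sq (hs : IsSetting val grad incl hess) (hD : 0 ≤ D) {z : ℝ → H} {u : ℝ → W}
    (hz : ∀ t, 0 ≤ t → z t = val (incl (u t)))
    (hd : ∀ t, 0 ≤ t → HasDerivWithinAt z (advDiffL grad incl hess c D (u t)) (Ici 0) t) :
    AntitoneOn (fun t => ‖z t‖ ^ 2) (Ici 0) := by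
  have hd2 : ∀ t ∈ Ioi (0 : ℝ), HasDerivAt (fun t => ‖z t‖ ^ 2)
      (2 * inner ℝ (z t) (advDiffL grad incl hess c D (u t))) t := fun t ht =>
    ((hd t (mem_Ioi.1 ht).le).hasDerivAt (Ici_mem_nhds ht)).norm_sq
  refine antitoneOn_of_deriv_nonpos (convex_Ici 0) ?_ ?_ ?_
  · exact fun t ht => ((hd t ht).continuousWithinAt.norm).pow 2
  · rw [interior_Ici]
    exact fun t ht => (hd2 t ht).differentiableAt.differentiableWithinAt
  · rw [interior_Ici]
    intro t ht
    rw [(hd2 t ht).deriv, hz t (mem_Ioi.1 ht).le, real_inner_comm, inner_advDiffL_self hs]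
    have : 0 ≤ D * ‖grad (incl (u t))‖ ^ 2 := by positivity
    linarith

theorem eq_zero_of_hasDerivWithinAt (hs : IsSetting val grad incl hess) (hD : 0 ≤ D) {z : ℝ → H}
    (hd : ∀ t, 0 ≤ t → ∃ u, z t = val (incl u) ∧
      HasDerivWithinAt z (advDiffL grad incl hess c D u) (Ici 0) t)
    (h0 : z 0 = 0) {t : ℝ} (ht : 0 ≤ t) : z t = 0 := by
  have : ∀ t, ∃ u, 0 ≤ t → z t = val (incl u) ∧
      HasDerivWithinAt z (advDiffL grad incl hess c D u) (Ici 0) t := by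
    intro t
    by_cases ht : 0 ≤ t
    · obtain ⟨u, hu⟩ := hd t ht
      exact ⟨u, fun _ => hu⟩
    · exact ⟨0, fun h => absurd h ht⟩
  choose u hu using this
  have h1 := antitoneOn_norm_sq hs hD (fun t ht => (hu t ht).1) (fun t ht => (hu t ht).2)
    (mem_Ici.2 le_rfl) (mem_Ici.2 ht) ht
  simp only [h0, norm_zero] at h1
  have h2 : ‖z t‖ = 0 := by
    have := norm_nonneg (z t)
    nlinarith
  exact norm_eq_zero.1 h2

theorem IsMild.unique [CompleteSpace H] (hs : IsSetting val grad incl hess) (hD : 0 ≤ D) {f : H}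
    {v v' : ℝ → H}
    (h : IsMild val grad incl hess c D f v) (h' : IsMild val grad incl hess c D f v')
    (hv : Continuous v) (hv' : Continuous v') {t : ℝ} (ht : 0 ≤ t) : v t = v' t := by
  have hd : ∀ t, HasDerivAt (fun t => ∫ s in (0 : ℝ)..t, (v s - v' s)) (v t - v' t) t := fun t =>
    ((hv.sub hv').integral_hasStrictDerivAt 0 t).hasDerivAt
  have h0 : ∀ t, 0 ≤ t → ∫ s in (0 : ℝ)..t, (v s - v' s) = 0 := by
    intro t ht
    refine eq_zero_of_hasDerivWithinAt (c := c) hs hD (z := fun t => ∫ s in (0 : ℝ)..t,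
      (v s - v' s)) (fun t ht => ?_) (by simp) ht
    obtain ⟨U, h1, h2⟩ := h t ht
    obtain ⟨U', h1', h2'⟩ := h' t ht
    refine ⟨U - U', ?_, ?_⟩
    · rw [map_sub, map_sub, h1, h1', intervalIntegral.integral_sub (hv.intervalIntegrable _ _)
        (hv'.intervalIntegrable _ _)]
    · have : advDiffL grad incl hess c D (U - U') = v t - v' t := by
        rw [map_sub, h2, h2', add_sub_add_left_eq_sub]
      rw [this]
      exact (hd t).hasDerivWithinAt
  have h1 : HasDerivWithinAt (fun t => ∫ s in (0 : ℝ)..t, (v s - v' s)) 0 (Ici 0) t :=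
    (hasDerivWithinAt_const t (Ici 0) (0 : H)).congr (fun s hs => h0 s hs) (h0 t ht)
  exact sub_eq_zero.1 ((uniqueDiffOn_Ici (0 : ℝ) t ht).eq_deriv _ (hd t).hasDerivWithinAt h1)

variable {T : ℝ → H →L[ℝ] W} {S₀ : ℝ → H →L[ℝ] H} {S₁ : ℝ → V →L[ℝ] V} {κ M l : ℝ}

theorem isMild_val (hT : IsDomainResolvent val grad incl hess c D T)
    (hg : Generates (fun l => (val.comp incl).comp (T l)) κ S₀) (hκ : 0 ≤ κ) (f : H) :
    IsMild val grad incl hess c D f fun t => S₀ t f := by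
  intro t ht
  have hl : 0 < κ + 1 := by linarith
  set I := ∫ s in (0 : ℝ)..t, S₀ s f
  have h1 : val (incl (T (κ + 1) (S₀ t f - f))) = (κ + 1) • val (incl (T (κ + 1) I)) - I :=
    (hg (κ + 1) (by linarith) t ht f).2
  have h3 : val (incl (T (κ + 1) ((κ + 1) • I - (S₀ t f - f)))) = I := by
    rw [map_sub, map_sub, map_sub, h1, map_smul, map_smul, map_smul]
    abel
  refine ⟨T (κ + 1) ((κ + 1) • I - (S₀ t f - f)), h3, ?_⟩
  rw [hT.advDiffL_apply hl, h3]
  abel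

theorem isMild_incl [CompleteSpace V] [CompleteSpace H]
    (hT : IsDomainResolvent val grad incl hess c D T)
    (hS : IsSemigroup S₁ M)
    (hg : Generates (fun l => (incl.comp (T l)).comp val) κ S₁) (hκ : 0 ≤ κ) (f : V) :
    IsMild val grad incl hess c D (val f) fun t => val (S₁ t f) := by
  intro t ht
  have hl : 0 < κ + 1 := by linarith
  rw [val.intervalIntegral_comp_comm ((hS.cont f).intervalIntegrable _ _)]
  set I := ∫ s in (0 : ℝ)..t, S₁ s f
  have h1 : incl (T (κ + 1) (val (S₁ t f - f))) = (κ + 1) • incl (T (κ + 1) (val I)) - I :=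
    (hg (κ + 1) (by linarith) t ht f).2
  have h3 : incl (T (κ + 1) (val ((κ + 1) • I - (S₁ t f - f)))) = I := by
    rw [map_sub, map_sub, map_sub, h1, map_smul, map_smul, map_smul]
    abel
  refine ⟨T (κ + 1) (val ((κ + 1) • I - (S₁ t f - f))), congrArg val h3, ?_⟩
  rw [hT.advDiffL_apply hl, h3]
  simp only [map_sub, map_smul]
  abel

theorem val_semigroup [CompleteSpace H] [CompleteSpace V] (hs : IsSetting val grad incl hess)
    (hD : 0 ≤ D) (hT : IsDomainResolvent val grad incl hess c D T)
    (hS₀ : IsSemigroup S₀ M) (hS₁ : IsSemigroup S₁ M)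
    (hg₀ : Generates (fun l => (val.comp incl).comp (T l)) κ S₀)
    (hg₁ : Generates (fun l => (incl.comp (T l)).comp val) κ S₁) (hκ : 0 ≤ κ) (f : V) {t : ℝ}
    (ht : 0 ≤ t) : val (S₁ t f) = S₀ t (val f) :=
  (isMild_incl hT hS₁ hg₁ hκ f).unique hs hD (isMild_val hT hg₀ hκ (val f))
    (val.continuous.comp (hS₁.cont f)) (hS₀.cont _) ht

/-- The curve `t ↦ T(l) S₀(t) g` solves the equation in the strict sense. -/
theorem hasDerivWithinAt_orbit [CompleteSpace H]
    (hT : IsDomainResolvent val grad incl hess c D T) (hS₀ : IsSemigroup S₀ M)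
    (hg₀ : Generates (fun l => (val.comp incl).comp (T l)) κ S₀) (hκ : 0 ≤ κ) (hl : κ < l) (g : H) :
    ContDiffOn ℝ 1 (fun t => val (incl (T l (S₀ t g)))) (Ici 0) ∧ ∀ t, 0 ≤ t →
      HasDerivWithinAt (fun t => val (incl (T l (S₀ t g))))
        (advDiffL grad incl hess c D (T l (S₀ t g))) (Ici 0) t := by
  obtain ⟨F, h1, h2, h3⟩ := IsResolvent.exists_contDiff_orbit hS₀ hg₀ hl g
  refine ⟨h1.contDiffOn.congr fun t ht => (h2 t ht).symm, fun t ht => ?_⟩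
  rw [hT.advDiffL_apply (hκ.trans_lt hl)]
  exact (h3 t).hasDerivWithinAt.congr (fun s hs => (h2 s hs).symm) (h2 t ht).symm

/-- The smoothing effect on the domain of the operator. -/
theorem norm_sq_semigroup_le [CompleteSpace H] [CompleteSpace V]
    (hs : IsSetting val grad incl hess) (hD : 0 < D)
    (hT : IsDomainResolvent val grad incl hess c D T) (hM : 0 ≤ M)
    (hS₀ : IsSemigroup S₀ M) (hS₁ : IsSemigroup S₁ M)
    (hg₀ : Generates (fun l => (val.comp incl).comp (T l)) κ S₀)
    (hg₁ : Generates (fun l => (incl.comp (T l)).comp val) κ S₁) (hκ : 0 ≤ κ) {a : ℝ} (ha : 0 < a)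
    (w : W) : ‖S₁ a (incl w)‖ ^ 2 ≤
      Real.exp (M * a) ^ 2 * (1 / (2 * D * a) + 1) * ‖val (incl w)‖ ^ 2 := by
  have hl : 0 < κ + 1 := by linarith
  set g := (κ + 1) • val (incl w) - advDiffL grad incl hess c D w
  have hw : T (κ + 1) g = w := (hT _ hl).2 w
  set u : ℝ → W := fun t => T (κ + 1) (S₀ t g)
  have hu : ∀ t, 0 ≤ t → incl (u t) = S₁ t (incl w) := by
    intro t ht
    refine hs.val_injective ?_
    rw [val_semigroup hs hD.le hT hS₀ hS₁ hg₀ hg₁ hκ _ ht, ← hw]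
    exact (hg₀ (κ + 1) (by linarith) t ht g).1
  have hd := (hasDerivWithinAt_orbit hT hS₀ hg₀ hκ (show κ < κ + 1 by linarith) g).2
  have hanti := antitoneOn_norm_sq hs hD.le (u := u) (fun t _ => rfl) hd
  have h0 : val (incl (T (κ + 1) (S₀ 0 g))) = val (incl w) := by
    rw [hS₀.zero, one_apply_eq_self, hw]
  have h0' : ‖val (incl (u 0))‖ = ‖val (incl w)‖ := congrArg norm h0
  set X := ‖S₁ a (incl w)‖
  set E := Real.exp (M * a)
  set N := ‖val (incl w)‖
  have hE : 0 < E := Real.exp_pos _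
  have hX : ∀ t ∈ Ioo 0 a, X ^ 2 ≤ E ^ 2 * ‖incl (u t)‖ ^ 2 := by
    intro t ht
    have h1 : S₁ a (incl w) = S₁ (a - t) (S₁ t (incl w)) := by
      have := hS₁.add (a - t) t (by linarith [ht.2]) ht.1.le
      rw [sub_add_cancel] at this
      rw [this]
      rfl
    rw [← mul_pow, hu t ht.1.le]
    refine pow_le_pow_left₀ (norm_nonneg _) ?_ 2
    change ‖S₁ a (incl w)‖ ≤ E * ‖S₁ t (incl w)‖
    rw [h1]
    refine ContinuousLinearMap.le_of_opNorm_le _ ((hS₁.bound _ (by linarith [ht.2])).trans ?_) _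
    refine Real.exp_le_exp.2 ?_
    gcongr
    linarith [ht.1]
  have hd2 : ∀ t ∈ Ioo 0 a, HasDerivAt (fun t => ‖val (incl (u t))‖ ^ 2)
      (2 * inner ℝ (val (incl (u t))) (advDiffL grad incl hess c D (u t))) t := fun t ht =>
    ((hd t ht.1.le).hasDerivAt (Ici_mem_nhds ht.1)).norm_sq
  have hmv := (convex_Icc (0 : ℝ) a).image_sub_le_mul_sub_of_deriv_le
    (f := fun t => ‖val (incl (u t))‖ ^ 2) (C := 2 * D * N ^ 2 - 2 * D * (X ^ 2 / E ^ 2))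
    (fun t ht => (((hd t ht.1).continuousWithinAt.norm).pow 2).mono Icc_subset_Ici_self)
    (by
      rw [interior_Icc]
      exact fun t ht => (hd2 t ht).differentiableAt.differentiableWithinAt)
    (by
      rw [interior_Icc]
      intro t ht
      rw [(hd2 t ht).deriv, real_inner_comm, inner_advDiffL_self hs]
      have h1 := hs.norm_sq (incl (u t))
      have h2 : ‖val (incl (u t))‖ ^ 2 ≤ N ^ 2 := by
        have := hanti (mem_Ici.2 le_rfl) (mem_Ici.2 ht.1.le) ht.1.le
        simp only [h0'] at this
        exact this
      have h3 : X ^ 2 / E ^ 2 ≤ ‖incl (u t)‖ ^ 2 := by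
        rw [div_le_iff₀ (by positivity), mul_comm]
        exact hX t ht
      nlinarith)
    0 (left_mem_Icc.2 ha.le) a (right_mem_Icc.2 ha.le) ha.le
  rw [h0', sub_zero] at hmv
  have h4 : 0 ≤ ‖val (incl (u a))‖ ^ 2 := by positivity
  have h5 : X ^ 2 / E ^ 2 ≤ (1 / (2 * D * a) + 1) * N ^ 2 := by
    have h6 : (1 / (2 * D * a) + 1) * N ^ 2 = (N ^ 2 + 2 * D * N ^ 2 * a) / (2 * D * a) := by
      field_simp
    rw [h6, le_div_iff₀ (by positivity)]
    nlinarith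
  rw [div_le_iff₀ (by positivity)] at h5
  linarith

/-- The smoothing effect: `S₀(a)` maps `L²` into `H₀¹` for `a > 0`. -/
theorem semigroup_mem_range_val [CompleteSpace H] [CompleteSpace V]
    (hs : IsSetting val grad incl hess) (hD : 0 < D)
    (hT : IsDomainResolvent val grad incl hess c D T) (hM : 0 ≤ M)
    (hS₀ : IsSemigroup S₀ M) (hS₁ : IsSemigroup S₁ M)
    (hg₀ : Generates (fun l => (val.comp incl).comp (T l)) κ S₀)
    (hg₁ : Generates (fun l => (incl.comp (T l)).comp val) κ S₁) (hκ : 0 ≤ κ) {a : ℝ} (ha : 0 < a)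
    (g : H) : ∃ q : V, val q = S₀ a g := by
  obtain ⟨x, hx, hxg⟩ := mem_closure_iff_seq_limit.1 (hs.dense_domain g)
  choose w hw using hx
  simp only at hw
  set K := Real.exp (M * a) ^ 2 * (1 / (2 * D * a) + 1)
  have hK : 0 ≤ K := by positivity
  have hb : ∀ n m, dist (S₁ a (incl (w n))) (S₁ a (incl (w m))) ≤ √K * dist (x n) (x m) := by
    intro n m
    have := norm_sq_semigroup_le hs hD hT hM hS₀ hS₁ hg₀ hg₁ hκ ha (w n - w m)
    rw [dist_eq_norm, dist_eq_norm, ← hw, ← hw, ← map_sub, ← map_sub, ← map_sub, ← map_sub]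
    refine le_of_sq_le_sq ?_ (by positivity)
    rw [mul_pow, Real.sq_sqrt hK]
    exact this
  have hc : CauchySeq fun n => S₁ a (incl (w n)) := by
    rw [cauchySeq_iff_tendsto_dist_atTop_0]
    have h1 := (cauchySeq_iff_tendsto_dist_atTop_0.1 hxg.cauchySeq).const_mul √K
    rw [mul_zero] at h1
    exact squeeze_zero (fun _ => dist_nonneg) (fun p => hb p.1 p.2) h1
  obtain ⟨q, hq⟩ := cauchySeq_tendsto_of_complete hc
  refine ⟨q, tendsto_nhds_unique ((val.continuous.tendsto q).comp hq) ?_⟩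
  refine (((S₀ a).continuous.tendsto g).comp hxg).congr fun n => ?_
  simp only [Function.comp_apply]
  rw [val_semigroup hs hD.le hT hS₀ hS₁ hg₀ hg₁ hκ _ ha.le, hw]

/-- The smoothing effect for strict solutions: they are `C¹` with values in `H₀¹` for `t > 0`. -/
theorem contDiffOn_incl_orbit [CompleteSpace H] [CompleteSpace V]
    (hs : IsSetting val grad incl hess) (hD : 0 < D)
    (hT : IsDomainResolvent val grad incl hess c D T) (hM : 0 ≤ M)
    (hS₀ : IsSemigroup S₀ M) (hS₁ : IsSemigroup S₁ M)
    (hg₀ : Generates (fun l => (val.comp incl).comp (T l)) κ S₀)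
    (hg₁ : Generates (fun l => (incl.comp (T l)).comp val) κ S₁) (hκ : 0 ≤ κ) (hl : κ < l) (g : H) :
    ContDiffOn ℝ 1 (fun t => incl (T l (S₀ t g))) (Ioi 0) := by
  intro t ht
  have ht' : 0 < t / 2 := half_pos ht
  obtain ⟨q, hq⟩ := semigroup_mem_range_val hs hD hT hM hS₀ hS₁ hg₀ hg₁ hκ ht' g
  obtain ⟨F, h1, h2, -⟩ := IsResolvent.exists_contDiff_orbit hS₁ hg₁ hl q
  have h3 : ContDiffAt ℝ 1 (fun s => F (s - t / 2)) t :=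
    (h1.comp (contDiff_id.sub contDiff_const)).contDiffAt
  refine (h3.congr_of_eventuallyEq ?_).contDiffWithinAt
  filter_upwards [Ioi_mem_nhds (half_lt_self ht)] with s hs'
  have hs0 : 0 ≤ s - t / 2 := sub_nonneg.2 (mem_Ioi.1 hs').le
  rw [h2 _ hs0]
  change _ = incl (T l (val (S₁ (s - t / 2) q)))
  rw [val_semigroup hs hD.le hT hS₀ hS₁ hg₀ hg₁ hκ _ hs0, hq]
  have := hS₀.add (s - t / 2) (t / 2) hs0 ht'.le
  rw [sub_add_cancel] at this
  rw [this]
  rfl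

/-- Existence of mild solutions with values in `H₀¹`. -/
theorem exists_mild [CompleteSpace H] [CompleteSpace V] [CompleteSpace W]
    (hs : IsSetting val grad incl hess) (hD : 0 < D) (f : V) :
    ∃ v : ℝ → V, Continuous v ∧ IsMild val grad incl hess c D (val f) fun t => val (v t) := by
  obtain ⟨T, hT⟩ := exists_isDomainResolvent (c := c) hs hD
  obtain ⟨S, hS, hg⟩ := (isResolvent_incl hs hD hT).exists_semigroup
  exact ⟨fun t => S t f, hS.cont f, isMild_incl hT hS hg (by positivity) f⟩

/-- Existence of strict solutions, and their regularity. -/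
theorem exists_strict [CompleteSpace H] [CompleteSpace V] [CompleteSpace W]
    (hs : IsSetting val grad incl hess) (hD : 0 < D) (w : W) :
    ∃ v : ℝ → W, Continuous v ∧ v 0 = w ∧
      ContDiffOn ℝ 1 (fun t => val (incl (v t))) (Ici 0) ∧
      (∀ t, 0 ≤ t → HasDerivWithinAt (fun t => val (incl (v t)))
        (advDiffL grad incl hess c D (v t)) (Ici 0) t) ∧
      IsMild val grad incl hess c D (val (incl w)) (fun t => val (incl (v t))) ∧
      ContDiffOn ℝ 1 (fun t => incl (v t)) (Ioi 0) := by
  obtain ⟨T, hT⟩ := exists_isDomainResolvent (c := c) hs hD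
  obtain ⟨S₀, hS₀, hg₀⟩ := (isResolvent_val hs hD hT).exists_semigroup
  obtain ⟨S₁, hS₁, hg₁⟩ := (isResolvent_incl hs hD hT).exists_semigroup
  set κ := c ^ 2 / (4 * D)
  have hκ : 0 ≤ κ := by positivity
  have hl : κ < κ + 1 := by linarith
  set g := (κ + 1) • val (incl w) - advDiffL grad incl hess c D w
  have hw : T (κ + 1) g = w := (hT _ (by linarith)).2 w
  obtain ⟨h1, h2⟩ := hasDerivWithinAt_orbit hT hS₀ hg₀ hκ hl g
  refine ⟨fun t => T (κ + 1) (S₀ t g), (T (κ + 1)).continuous.comp (hS₀.cont g), ?_, h1, h2, ?_,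
    contDiffOn_incl_orbit hs hD hT (by positivity) hS₀ hS₁ hg₀ hg₁ hκ hl g⟩
  · simp only [hS₀.zero, one_apply_eq_self, hw]
  · refine (isMild_val hT hg₀ hκ (val (incl w))).congr fun t ht => ?_
    rw [← hw]
    exact (hg₀ (κ + 1) hl t ht g).1.symm

end Dirichlet

namespace HalfLine

open Filter Topology

/-! ### Test functions and weak derivatives through the inner product of `L²` -/

theorem IsTest.deriv {φ : ℝ → ℝ} (h : IsTest φ) : IsTest (deriv φ) where
  smooth := (contDiff_infty_iff_deriv.1 h.smooth).2
  compact := h.compact.deriv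
  supp := (tsupport_deriv_subset).trans h.supp

/-- The class in `L²(ℝ₊)` of a test function. -/
def IsTest.toL2 {φ : ℝ → ℝ} (h : IsTest φ) : L2 := h.memLp.toLp φ

theorem IsTest.coeFn_toL2 {φ : ℝ → ℝ} (h : IsTest φ) :
    h.toL2 =ᵐ[volume.restrict (Ioi (0 : ℝ))] φ := h.memLp.coeFn_toLp

theorem IsTest.inner_toL2 {φ : ℝ → ℝ} (h : IsTest φ) (f : L2) :
    inner ℝ f h.toL2 = ∫ x in Ioi (0 : ℝ), f x * φ x := by
  rw [L2.inner_def]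
  refine integral_congr_ae ?_
  filter_upwards [h.coeFn_toL2] with x hx
  simp [hx, mul_comm]

theorem isWeakDeriv_iff {f g : L2} :
    IsWeakDeriv f g ↔ ∀ (φ : ℝ → ℝ) (h : IsTest φ),
      inner ℝ f h.deriv.toL2 = - inner ℝ g h.toL2 := by
  simp only [IsTest.inner_toL2]
  rfl

theorem IsTest.isWeakDeriv {φ : ℝ → ℝ} (h : IsTest φ) : IsWeakDeriv h.toL2 h.deriv.toL2 := by
  intro ψ hψ
  have e1 : ∫ x in Ioi (0 : ℝ), h.toL2 x * _root_.deriv ψ x = ∫ x, φ x * _root_.deriv ψ x := by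
    have h0 : ∫ x in Ioi (0 : ℝ), φ x * _root_.deriv ψ x = ∫ x, φ x * _root_.deriv ψ x :=
      setIntegral_eq_integral_of_forall_compl_eq_zero fun x hx => by
        rw [image_eq_zero_of_notMem_tsupport (fun hx' => hx (h.supp hx')), zero_mul]
    rw [← h0]
    refine integral_congr_ae ?_
    filter_upwards [h.coeFn_toL2] with x hx
    rw [hx]
  have e2 : ∫ x in Ioi (0 : ℝ), h.deriv.toL2 x * ψ x = ∫ x, _root_.deriv φ x * ψ x := by
    have h0 : ∫ x in Ioi (0 : ℝ), _root_.deriv φ x * ψ x = ∫ x, _root_.deriv φ x * ψ x :=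
      setIntegral_eq_integral_of_forall_compl_eq_zero fun x hx => by
        rw [image_eq_zero_of_notMem_tsupport (fun hx' => hx (hψ.supp hx')), mul_zero]
    rw [← h0]
    refine integral_congr_ae ?_
    filter_upwards [h.deriv.coeFn_toL2] with x hx
    rw [hx]
  rw [e1, e2]
  have hc := h.smooth.continuous
  have hc' := hψ.smooth.continuous
  have hd := h.deriv.smooth.continuous
  have hd' := hψ.deriv.smooth.continuous
  refine integral_mul_deriv_eq_deriv_mul_of_integrable
    (fun x _ => (h.smooth.differentiable (by simp) x).hasDerivAt)
    (fun x _ => (hψ.smooth.differentiable (by simp) x).hasDerivAt) ?_ ?_ ?_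
  · exact (hc.mul hd').integrable_of_hasCompactSupport h.compact.mul_right
  · exact (hd.mul hc').integrable_of_hasCompactSupport h.compact.deriv.mul_right
  · exact (hc.mul hc').integrable_of_hasCompactSupport h.compact.mul_right

theorem eq_zero_of_inner_test {f : L2}
    (hf : ∀ (φ : ℝ → ℝ) (h : IsTest φ), inner ℝ f h.toL2 = 0) : f = 0 := by
  have hloc : LocallyIntegrableOn f (Ioi (0 : ℝ)) volume :=
    locallyIntegrableOn_of_locallyIntegrable_restrict
      ((Lp.memLp f).locallyIntegrable (by norm_num))
  have := isOpen_Ioi.ae_eq_zero_of_integral_contDiff_smul_eq_zero hloc (fun φ h1 h2 h3 => by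
    have ht : IsTest φ := ⟨h1, h2, h3⟩
    have h0 := hf φ ht
    rw [ht.inner_toL2] at h0
    have h4 : ∫ x in Ioi (0 : ℝ), f x * φ x = ∫ x, f x * φ x :=
      setIntegral_eq_integral_of_forall_compl_eq_zero fun x hx => by
        rw [image_eq_zero_of_notMem_tsupport (fun hx' => hx (h3 hx')), mul_zero]
    simp only [smul_eq_mul, mul_comm (φ _)]
    rw [← h4, h0])
  refine Lp.ext ?_
  filter_upwards [(ae_restrict_iff' measurableSet_Ioi).2 this,
    Lp.coeFn_zero ℝ 2 (volume.restrict (Ioi (0 : ℝ)))] with x hx h0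
  rw [hx, h0, Pi.zero_apply]

theorem IsWeakDeriv.unique {f g g' : L2} (h : IsWeakDeriv f g) (h' : IsWeakDeriv f g') :
    g = g' := by
  refine sub_eq_zero.1 (eq_zero_of_inner_test fun φ hφ => ?_)
  have h1 := isWeakDeriv_iff.1 h φ hφ
  have h2 := isWeakDeriv_iff.1 h' φ hφ
  rw [inner_sub_left]
  linarith

theorem isClosed_sobolev (k : ℕ) :
    IsClosed (Sobolev k : Set (PiLp 2 (fun _ : Fin (k + 1) => L2))) := by
  have : (Sobolev k : Set (PiLp 2 (fun _ : Fin (k + 1) => L2))) =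
      ⋂ (i : Fin k) (φ : ℝ → ℝ) (h : IsTest φ),
        {u | inner ℝ (u i.castSucc) h.deriv.toL2 = - inner ℝ (u i.succ) h.toL2} := by
    ext u
    simp only [mem_iInter, mem_ofPred_eq]
    exact forall_congr' fun i => isWeakDeriv_iff
  rw [this]
  refine isClosed_iInter fun i => isClosed_iInter fun φ => isClosed_iInter fun h => ?_
  refine isClosed_eq ?_ ?_
  · exact ((PiLp.continuous_apply 2 _ i.castSucc).inner continuous_const)
  · exact ((PiLp.continuous_apply 2 _ i.succ).inner continuous_const).neg

instance completeSpace_sobolev (k : ℕ) : CompleteSpace (Sobolev k) :=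
  (isClosed_sobolev k).completeSpace_coe

instance completeSpace_H01 : CompleteSpace H01 :=
  (testH1.isClosed_topologicalClosure).completeSpace_coe

/-- The `i`-th weak derivative, as a continuous linear map on `H^k(ℝ₊)`. -/
def coord (k : ℕ) (i : Fin (k + 1)) : Sobolev k →L[ℝ] L2 :=
  (PiLp.proj 2 (fun _ : Fin (k + 1) => L2) i).comp (Sobolev k).subtypeL

/-- The inclusion of `H²(ℝ₊)` in `H¹(ℝ₊)`, as a continuous linear map. -/
def toH1L : H2 →L[ℝ] H1 where
  toLinearMap := H2.toH1
  cont := by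
    refine Continuous.subtype_mk ?_ _
    refine (PiLp.continuous_toLp 2 _).comp ?_
    exact continuous_pi fun i => (coord 2 i.castSucc).continuous

instance completeSpace_H01H2 : CompleteSpace H01H2 := by
  have : IsClosed (H01H2 : Set H2) :=
    (testH1.isClosed_topologicalClosure).preimage toH1L.continuous
  exact this.completeSpace_coe

/-- The inclusion of `H₀¹(ℝ₊)` in `L²(ℝ₊)`. -/
def val : H01 →L[ℝ] L2 := (coord 1 0).comp H01.subtypeL

/-- The derivative from `H₀¹(ℝ₊)` to `L²(ℝ₊)`. -/
def grad : H01 →L[ℝ] L2 := (coord 1 1).comp H01.subtypeL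

/-- The inclusion of `H₀¹(ℝ₊) ∩ H²(ℝ₊)` in `H₀¹(ℝ₊)`. -/
def incl : H01H2 →L[ℝ] H01 :=
  (toH1L.comp H01H2.subtypeL).codRestrict H01 (fun u => u.2)

/-- The second derivative from `H₀¹(ℝ₊) ∩ H²(ℝ₊)` to `L²(ℝ₊)`. -/
def hess : H01H2 →L[ℝ] L2 := (coord 2 2).comp H01H2.subtypeL

theorem isWeakDeriv_grad (u : H01) : IsWeakDeriv (val u) (grad u) := u.1.2 0

theorem isWeakDeriv_hess (u : H01H2) : IsWeakDeriv (grad (incl u)) (hess u) := u.1.2 1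

theorem norm_sq_H01 (u : H01) : ‖u‖ ^ 2 = ‖val u‖ ^ 2 + ‖grad u‖ ^ 2 := by
  have := PiLp.norm_sq_eq_of_L2 (fun _ : Fin 2 => L2) u.1.1
  rw [Fin.sum_univ_two] at this
  exact this

theorem val_injective : Function.Injective val := by
  intro u w h
  have h1 : grad u = grad w := (isWeakDeriv_grad u).unique (h ▸ isWeakDeriv_grad w)
  refine Subtype.ext (Subtype.ext (PiLp.ext fun i => ?_))
  fin_cases i
  · exact h
  · exact h1

theorem incl_injective : Function.Injective incl := by
  intro u w h
  have h2 : hess u = hess w := (isWeakDeriv_hess u).unique (h ▸ isWeakDeriv_hess w)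
  have h0 : val (incl u) = val (incl w) := by rw [h]
  have h1 : grad (incl u) = grad (incl w) := by rw [h]
  refine Subtype.ext (Subtype.ext (PiLp.ext fun i => ?_))
  fin_cases i
  · exact h0
  · exact h1
  · exact h2

/-- The class in `H₀¹(ℝ₊)` of a test function. -/
def IsTest.toH01 {φ : ℝ → ℝ} (h : IsTest φ) : H01 :=
  ⟨⟨WithLp.toLp 2 ![h.toL2, h.deriv.toL2], fun i => by
    fin_cases i
    exact h.isWeakDeriv⟩, testH1.le_topologicalClosure ⟨φ, h, h.coeFn_toL2⟩⟩

theorem IsTest.val_toH01 {φ : ℝ → ℝ} (h : IsTest φ) : val h.toH01 = h.toL2 := rfl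

theorem IsTest.grad_toH01 {φ : ℝ → ℝ} (h : IsTest φ) : grad h.toH01 = h.deriv.toL2 := rfl

/-- An element of `H₀¹(ℝ₊)` whose derivative has a weak derivative in `L²(ℝ₊)` is in `H²(ℝ₊)`. -/
theorem exists_incl_eq (u : H01) {g : L2} (h : IsWeakDeriv (grad u) g) :
    ∃ w : H01H2, incl w = u ∧ hess w = g := by
  refine ⟨⟨⟨WithLp.toLp 2 ![val u, grad u, g], fun i => ?_⟩, ?_⟩, ?_, rfl⟩
  · fin_cases i
    · exact isWeakDeriv_grad u
    · exact h
  · have : H2.toH1 ⟨WithLp.toLp 2 ![val u, grad u, g], fun i => by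
        fin_cases i
        · exact isWeakDeriv_grad u
        · exact h⟩ = u.1 := by
      refine Subtype.ext (PiLp.ext fun i => ?_)
      fin_cases i <;> rfl
    change H2.toH1 _ ∈ H01
    rw [this]
    exact u.2
  · refine Subtype.ext (Subtype.ext (PiLp.ext fun i => ?_))
    fin_cases i <;> rfl

theorem exists_test_incl {φ : ℝ → ℝ} (h : IsTest φ) :
    ∃ w : H01H2, incl w = h.toH01 ∧ hess w = h.deriv.deriv.toL2 :=
  exists_incl_eq _ (by rw [h.grad_toH01]; exact h.deriv.isWeakDeriv)

theorem dense_test_H01 {P : H01 → Prop} (hP : IsClosed {u | P u})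
    (h : ∀ (φ : ℝ → ℝ) (hφ : IsTest φ), P hφ.toH01) (u : H01) : P u := by
  obtain ⟨x, hx, hxu⟩ := mem_closure_iff_seq_limit.1
    (show (u : H1) ∈ closure (testH1 : Set H1) from u.2)
  have hx' : ∀ n, ∃ (φ : ℝ → ℝ) (hφ : IsTest φ), (hφ.toH01 : H1) = x n := by
    intro n
    obtain ⟨φ, hφ, he⟩ := hx n
    refine ⟨φ, hφ, ?_⟩
    have : hφ.toH01 = ⟨x n, testH1.le_topologicalClosure (hx n)⟩ :=
      val_injective (Lp.ext (hφ.coeFn_toL2.trans he.symm))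
    rw [this]
  choose φ hφ he using hx'
  refine hP.mem_of_tendsto (f := fun n => (hφ n).toH01) (b := atTop) ?_
    (Eventually.of_forall fun n => h _ _)
  rw [tendsto_subtype_rng]
  simpa only [he] using hxu

/-- Integration by parts: there is no boundary term since one factor is in `H₀¹(ℝ₊)`. -/
theorem inner_grad_eq {f g : L2} (h : IsWeakDeriv f g) (w : H01) :
    inner ℝ f (grad w) = - inner ℝ g (val w) := by
  refine dense_test_H01 (P := fun w => inner ℝ f (grad w) = - inner ℝ g (val w)) ?_ ?_ w
  · exact isClosed_eq (continuous_const.inner grad.continuous)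
      (continuous_const.inner val.continuous).neg
  · intro φ hφ
    exact isWeakDeriv_iff.1 h φ hφ

theorem inner_val_grad_self (u : H01) : inner ℝ (val u) (grad u) = 0 := by
  have := inner_grad_eq (isWeakDeriv_grad u) u
  rw [real_inner_comm (val u) (grad u)] at this
  linarith

theorem inner_hess_val (u : H01H2) (w : H01) :
    inner ℝ (hess u) (val w) = - inner ℝ (grad (incl u)) (grad w) := by
  rw [inner_grad_eq (isWeakDeriv_hess u) w, neg_neg]

theorem denseRange_val_incl : DenseRange (fun u : H01H2 => val (incl u)) := by
  have key : (LinearMap.range (val.comp incl : H01H2 →L[ℝ] L2).toLinearMap).topologicalClosure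
      = ⊤ := by
    rw [Submodule.topologicalClosure_eq_top_iff, Submodule.eq_bot_iff]
    intro f hf
    refine eq_zero_of_inner_test fun φ hφ => ?_
    obtain ⟨w, hw, -⟩ := exists_test_incl hφ
    rw [Submodule.mem_orthogonal'] at hf
    refine hf _ ⟨w, ?_⟩
    change val (incl w) = _
    rw [hw, hφ.val_toH01]
  rw [denseRange_iff_closure_range]
  exact congrArg SetLike.coe key

open Dirichlet

/-! ### The Dirichlet problem on the half-line -/

local instance normedAddCommGroup_H01 : NormedAddCommGroup H01 := H01.normedAddCommGroup

local instance innerProductSpace_H01 : InnerProductSpace ℝ H01 := H01.innerProductSpace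

local instance normedAddCommGroup_H01H2 : NormedAddCommGroup H01H2 := H01H2.normedAddCommGroup

local instance normedSpace_H01H2 : NormedSpace ℝ H01H2 := H01H2.normedSpace

theorem isSetting : IsSetting (H := L2) (V := H01) (W := H01H2) val grad incl hess where
  norm_sq := norm_sq_H01
  val_injective := val_injective
  incl_injective := incl_injective
  inner_val_grad := inner_val_grad_self
  inner_hess_val := inner_hess_val
  regular := fun u g h => exists_incl_eq u (isWeakDeriv_iff.2 fun _ hφ => h hφ.toH01)
  dense_domain := denseRange_val_incl
  dense_smooth := by
    refine fun u => dense_test_H01 isClosed_closure (fun φ hφ => subset_closure ?_) u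
    obtain ⟨w, hw, hw'⟩ := exists_test_incl hφ
    refine ⟨w, hw, ⟨hφ.deriv.toH01, ?_⟩, ⟨hφ.deriv.deriv.toH01, ?_⟩⟩
    · rw [hφ.grad_toH01, IsTest.val_toH01]
    · rw [hw', IsTest.val_toH01]

theorem isMildSolution_iff {b m₁ m₂ N : ℝ} {f : H01} {v : ℝ≥0 → H01} :
    IsMildSolution b m₁ m₂ N f v ↔
      IsMild (H := L2) (V := H01) (W := H01H2) val grad incl hess (b * m₁) (b * m₂ / (2 * N)) (val f)
        (fun t => val (v t.toNNReal)) := by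
  refine ⟨fun h t ht => ?_, fun h t => ?_⟩
  · obtain ⟨U, h1, h2⟩ := h t.toNNReal
    rw [Real.coe_toNNReal t ht] at h1
    exact ⟨U, h1, h2⟩
  · obtain ⟨U, h1, h2⟩ := h t t.coe_nonneg
    simp only [Real.toNNReal_coe] at h2
    exact ⟨U, h1, h2⟩

theorem moment_two_pos {g : ℝ → ℝ} {δ : ℝ} (hδ : 0 < δ) (hg_nonneg : ∀ v ∈ Icc 0 δ, 0 ≤ g v)
    (hg_int : IntervalIntegrable g volume 0 δ) (hg_one : ∫ v in (0 : ℝ)..δ, g v = 1) :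
    0 < moment g δ 2 := by
  have hi : IntervalIntegrable (fun v => v ^ 2 * g v) volume 0 δ :=
    hg_int.continuousOn_mul (continuous_pow 2).continuousOn
  have h1 : 0 < ∫ v in (0 : ℝ)..δ, g v := by rw [hg_one]; exact one_pos
  have hae : ∀ᵐ v ∂(volume.restrict (Ioc 0 δ)), 0 ≤ g v := by
    filter_upwards [ae_restrict_mem measurableSet_Ioc] with v hv
    exact hg_nonneg v ⟨hv.1.le, hv.2⟩
  rw [intervalIntegral.integral_pos_iff_support_of_nonneg_ae'
    (by rw [uIoc_of_le hδ.le]; exact hae) hg_int] at h1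
  rw [moment, intervalIntegral.integral_pos_iff_support_of_nonneg_ae' _ hi]
  · refine ⟨hδ, h1.2.trans_le (measure_mono ?_)⟩
    rintro v ⟨hv, hv'⟩
    exact ⟨mul_ne_zero (pow_ne_zero 2 hv'.1.ne') hv, hv'⟩
  · rw [uIoc_of_le hδ.le]
    filter_upwards [hae] with v hv
    exact mul_nonneg (sq_nonneg v) hv

theorem existsUnique_isMildSolution {b m₁ m₂ N : ℝ} (hD : 0 < b * m₂ / (2 * N)) (f : H01) :
    ∃! v : C(ℝ≥0, H01), IsMildSolution b m₁ m₂ N f v := by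
  obtain ⟨v, hv, hm⟩ := exists_mild (c := b * m₁) isSetting hD f
  refine ⟨⟨fun t => v t, hv.comp NNReal.continuous_coe⟩, ?_, fun w hw => ?_⟩
  · refine isMildSolution_iff.2 (hm.congr fun t ht => ?_)
    simp [Real.coe_toNNReal t ht]
  · ext1 t
    refine val_injective ?_
    change val (w t) = val (v t)
    have hcont : Continuous fun t : ℝ => val (w t.toNNReal) :=
      val.continuous.comp (w.continuous.comp continuous_real_toNNReal)
    have := (isMildSolution_iff.1 hw).unique isSetting hD.le hm hcont (val.continuous.comp hv)
      t.coe_nonneg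
    simpa only [Real.toNNReal_coe] using this

theorem IsStrictSolution.unique {b m₁ m₂ N : ℝ} (hD : 0 ≤ b * m₂ / (2 * N)) {f : H01}
    {v w : ℝ≥0 → H01H2} (hv : IsStrictSolution b m₁ m₂ N f v)
    (hw : IsStrictSolution b m₁ m₂ N f w) : w = v := by
  have h0 : ∀ t : ℝ, 0 ≤ t → val (incl (w t.toNNReal)) - val (incl (v t.toNNReal)) = 0 := by
    intro t ht
    refine eq_zero_of_hasDerivWithinAt (c := b * m₁) isSetting hD
      (z := fun t => val (incl (w t.toNNReal)) - val (incl (v t.toNNReal))) (fun t ht => ?_) ?_ ht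
    · refine ⟨w t.toNNReal - v t.toNNReal, by rw [map_sub, map_sub], ?_⟩
      have h1 := (hw.eqn t.toNNReal).sub (hv.eqn t.toNNReal)
      rw [Real.coe_toNNReal t ht] at h1
      rw [map_sub]
      exact h1
    · have h1 : incl (w 0) = incl (v 0) := hw.initial.trans hv.initial.symm
      simp only [Real.toNNReal_zero, h1, sub_self]
  ext1 t
  have := h0 t t.coe_nonneg
  rw [Real.toNNReal_coe, sub_eq_zero] at this
  exact incl_injective (val_injective this)

theorem exists_isStrictSolution {b m₁ m₂ N : ℝ} (hD : 0 < b * m₂ / (2 * N)) (u : H01H2) :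
    ∃ v : C(ℝ≥0, H01H2), IsStrictSolution b m₁ m₂ N (h01H2ToH01 u) v ∧
      IsMildSolution b m₁ m₂ N (h01H2ToH01 u) (fun t => h01H2ToH01 (v t)) ∧
      ContDiffOn ℝ 1 (fun t : ℝ => h01H2ToH01 (v t.toNNReal)) (Ioi 0) := by
  obtain ⟨v, hv, h0, h1, h2, h3, h4⟩ := exists_strict (c := b * m₁) isSetting hD u
  have he : ∀ t : ℝ, 0 ≤ t → v (t.toNNReal : ℝ) = v t := fun t ht => by
    rw [Real.coe_toNNReal t ht]
  refine ⟨⟨fun t => v t, hv.comp NNReal.continuous_coe⟩, ⟨?_, fun t => ?_, ?_⟩, ?_, ?_⟩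
  · refine h1.congr fun t ht => ?_
    change val (incl (v (t.toNNReal : ℝ))) = _
    rw [he t ht]
  · refine (h2 t t.coe_nonneg).congr (fun s hs => ?_) ?_
    · change val (incl (v (s.toNNReal : ℝ))) = _
      rw [he s hs]
    · change val (incl (v ((t : ℝ).toNNReal : ℝ))) = _
      rw [he t t.coe_nonneg]
  · change incl (v ((0 : ℝ≥0) : ℝ)) = incl u
    rw [NNReal.coe_zero, h0]
  · refine isMildSolution_iff.2 (h3.congr fun t ht => ?_)
    change _ = val (incl (v (t.toNNReal : ℝ)))
    rw [he t ht]
  · refine h4.congr fun t ht => ?_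
    change incl (v (t.toNNReal : ℝ)) = _
    rw [he t (mem_Ioi.1 ht).le]

end HalfLine

end

theorem mainTheorem3
    (b δ N : ℝ) (hb : 0 < b) (hδ : 0 < δ) (hN : 0 < N)
    (g : ℝ → ℝ) (hg_nonneg : ∀ v ∈ Set.Icc 0 δ, 0 ≤ g v)
    (hg_int : IntervalIntegrable g MeasureTheory.volume 0 δ)
    (hg_one : ∫ v in (0 : ℝ)..δ, g v = 1)
    (m₁ m₂ : ℝ) (hm₁ : m₁ = HalfLine.moment g δ 1) (hm₂ : m₂ = HalfLine.moment g δ 2)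
    (f : HalfLine.H01) :
    (∃! v : C(NNReal, HalfLine.H01), HalfLine.IsMildSolution b m₁ m₂ N f v) ∧
    (f ∈ Set.range HalfLine.h01H2ToH01 →
      ∃ v : C(NNReal, HalfLine.H01H2),
        HalfLine.IsStrictSolution b m₁ m₂ N f v ∧
        (∀ w : C(NNReal, HalfLine.H01H2), HalfLine.IsStrictSolution b m₁ m₂ N f w → w = v) ∧
        HalfLine.IsMildSolution b m₁ m₂ N f (fun t => HalfLine.h01H2ToH01 (v t)) ∧
        ContDiffOn ℝ 1 (fun t : ℝ => HalfLine.h01H2ToH01 (v t.toNNReal)) (Set.Ioi 0)) := by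
  have hm : 0 < m₂ := hm₂ ▸ HalfLine.moment_two_pos hδ hg_nonneg hg_int hg_one
  have hD : 0 < b * m₂ / (2 * N) := by positivity
  refine ⟨HalfLine.existsUnique_isMildSolution hD f, ?_⟩
  rintro ⟨u, rfl⟩
  obtain ⟨v, h1, h2, h3⟩ := HalfLine.exists_isStrictSolution (m₁ := m₁) hD u
  exact ⟨v, h1, fun w hw => DFunLike.coe_injective (h1.unique hD.le hw), h2, h3⟩
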